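/- Let $G=(V,E)$ be a finite simple graph. For a weighting $\omega:E\to\{1,\dots,k\}$ of its edges put $\sigma_\omega(v)=\sum_{e\ni v}\omega(e)$ for $v\in V$. The irregularity strength $s(G)$ is the least positive integer $k$ for which there is a weighting $\omega:E\to\{1,\dots,k\}$ with $\sigma_\omega(u)\ne\sigma_\omega(v)$ for all distinct $u,v\in V$; it is undefined if there is no such $k$. Let $\varepsilon_0>0$ be fixed. (i) There is an $N$, depending only on $\varepsilon_0$, such that for every $n\ge N$ and every $d$-regular graph $G$ with $n$ vertices and $\ln^{1+\varepsilon_0} n\le d\le \dfrac{n}{\ln^{\varepsilon_0} n}$, the irregularity strength $s(G)$ is defined and $$s(G)\le \frac{n}{d}\left(1+\frac{1}{\ln^{\varepsilon_0/19} n}\right).$$ (ii) Hence $s(G)=(1+o(1))\frac{n}{d}$ in this range, uniformly in $d$ and $G$ as $n\to\infty$: for every $\delta>0$ there is an $N$, depending only on $\varepsilon_0$ and $\delta$, such that for every $n\ge N$ and every $d$-regular graph $G$ with $n$ vertices and $\ln^{1+\varepsilon_0} n\le d\le \dfrac{n}{\ln^{\varepsilon_0} n}$, the irregularity strength $s(G)$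 is defined and $\left|s(G)-\frac nd\right|\le\delta\,\frac nd$. -/

import Mathlib

universe u

namespace SimpleGraph

variable {V : Type u} [Fintype V]

open Classical in
/-- The weighted degree of the vertex `v`: the sum of the weights of the edges of `G` that contain
`v`. Only the values of `ω` on edges of `G` matter. -/
noncomputable def weightedDegree (G : SimpleGraph V) (ω : Sym2 V → ℕ) (v : V) : ℕ :=
  ∑ e ∈ G.incidenceFinset v, ω e

/-- `G` has a weighting of its edges by integers from `{1, …, k}` for which distinct vertices have
distinct weighted degrees. -/
def HasIrregularWeighting (G : SimpleGraph V) (k : ℕ) : Prop :=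
  ∃ ω : Sym2 V → ℕ, (∀ e ∈ G.edgeSet, ω e ∈ Set.Icc 1 k) ∧
    ∀ u v : V, u ≠ v → G.weightedDegree ω u ≠ G.weightedDegree ω v

/-- The irregularity strength of `G` is defined: some positive integer `k` admits an irregular
weighting with weights from `{1, …, k}`. -/
def IrregularityStrengthDefined (G : SimpleGraph V) : Prop :=
  ∃ k : ℕ, 1 ≤ k ∧ G.HasIrregularWeighting k

/-- The irregularity strength `s(G)`: the least positive integer `k` such that `G` has an irregular
weighting with weights from `{1, …, k}`. It is meaningful when
`G.IrregularityStrengthDefined` holds, and `0` otherwise. -/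
noncomputable def irregularityStrength (G : SimpleGraph V) : ℕ :=
  sInf {k : ℕ | 1 ≤ k ∧ G.HasIrregularWeighting k}

end SimpleGraph

/-! Take a parameter `q` of order `log n ^ (ε₀/19)`, put `r = 10000 q` and `K = q r²`, and give
every vertex a level below `K` and a type below `r`. A Chernoff bound
(`exists_coloring_neighbor_count`) makes all level-type pairs almost equally frequent in every
neighbourhood. Each edge gets a base weight `lo`, and `K h` more if the levels of its ends sum to at
least `K`. A vertex of level `i` sees about `i d / K` such neighbours, so its weighted degree is
within `h d` of `lo d + h d i`. With `h` slightly above `n / (d K)`, the levels own consecutive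
windows of length `h d`, each a little longer than the number (about `n / K`) of vertices of that
level. The dominant cost is `K h`, about `n / d`.

Vertices of type at least 2 are then moved exactly to distinct targets in their windows, the
corrections being spread over the edges to the small vertices, those of types 0 and 1. The small
vertices absorb the resulting errors and are separated last, through edges between types 0 and 1
only (`exists_bipartite_adjustment`). Small vertices avoid all targets because the residues 0 and 1
modulo `2q` of `⌊x / M⌋`, with `M = r² h`, are reserved for them; this costs a proportion `1/q` of
each window. Base weight and corrections are `O(h r²)` per edge, a proportion `O(1/q)` of `K h`.

The separation has two scales. Shifts in `[0, M)` spread the degrees modulo `M`, so that few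
conflicting vertices share a residue (`exists_few_equal_residues`). Multiples of `M` then separate
the quotients greedily, one vertex at a time: a type 0 vertex keeps two admissible quotients `y` and
`y + 1`, which gives type 1 vertices the freedom to move.

For the lower bound, weighted degrees are distinct integers in `[d, k d]`. -/

open Finset

/-! ### Equitable random colourings -/

/-- The moment generating function of a centred uniform indicator. -/
theorem sum_exp_indicator_sub_le {κ : Type*} [Fintype κ] [DecidableEq κ] [Nonempty κ] (i : κ)
    {s : ℝ} (hs : |s| ≤ 1) :
    ∑ j : κ, Real.exp (s * ((if j = i then 1 else 0) - 1 / (Fintype.card κ : ℝ))) ≤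
      Fintype.card κ * Real.exp (s ^ 2) := by
  have hC : (1 : ℝ) ≤ Fintype.card κ := by exact_mod_cast Fintype.card_pos
  have hC0 : (Fintype.card κ : ℝ) ≠ 0 := by positivity
  set y : κ → ℝ := fun j => (if j = i then 1 else 0) - 1 / (Fintype.card κ : ℝ) with hy
  have hinv : 1 / (Fintype.card κ : ℝ) ≤ 1 := by
    rw [div_le_one (by positivity)]; exact hC
  have hinv0 : 0 ≤ 1 / (Fintype.card κ : ℝ) := by positivity
  have hy1 : ∀ j, |y j| ≤ 1 := by
    intro j
    simp only [hy]
    rw [abs_le]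
    split_ifs <;> constructor <;> linarith
  have hysum : ∑ j, y j = 0 := by
    simp only [hy, Finset.sum_sub_distrib, Finset.sum_ite_eq', Finset.mem_univ, if_true,
      Finset.sum_const, Finset.card_univ, nsmul_eq_mul]
    field_simp
    simp
  -- On summation the linear term vanishes by `hysum`, leaving only the quadratic one.
  have hterm : ∀ j, Real.exp (s * y j) ≤ 1 + s * y j + s ^ 2 := by
    intro j
    have h1 : |s * y j| ≤ 1 := by
      rw [abs_mul]
      exact mul_le_one₀ hs (abs_nonneg _) (hy1 j)
    have h2 := (abs_le.mp (Real.abs_exp_sub_one_sub_id_le h1)).2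
    have h3 : (s * y j) ^ 2 ≤ s ^ 2 := by
      rw [mul_pow]
      have : y j ^ 2 ≤ 1 := by
        rw [← sq_abs]; exact pow_le_one₀ (abs_nonneg _) (hy1 j)
      nlinarith [sq_nonneg s]
    linarith
  calc ∑ j, Real.exp (s * y j) ≤ ∑ j, (1 + s * y j + s ^ 2) := Finset.sum_le_sum fun j _ => hterm j
    _ = Fintype.card κ * (s ^ 2 + 1) := by
      rw [Finset.sum_add_distrib, Finset.sum_add_distrib, ← Finset.mul_sum, hysum]
      simp
      ring
    _ ≤ _ := by
      gcongr
      exact Real.add_one_le_exp _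

/-- Independence of the colours: the exponential is a product over vertices, so the sum over
colourings factors into one-vertex sums. -/
theorem sum_colorings_exp_le {V κ : Type*} [Fintype V] [DecidableEq V] [Fintype κ] [DecidableEq κ]
    [Nonempty κ] (N : Finset V) (i : κ) {s : ℝ} (hs : |s| ≤ 1) :
    ∑ c : V → κ, Real.exp (s * (#{u ∈ N | c u = i} - #N / (Fintype.card κ : ℝ))) ≤
      (Fintype.card κ : ℝ) ^ Fintype.card V * Real.exp (s ^ 2 * #N) := by
  set F : V → κ → ℝ := fun u j => if u ∈ N then
    Real.exp (s * ((if j = i then 1 else 0) - 1 / (Fintype.card κ : ℝ))) else 1 with hF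
  have h1 : ∀ c : V → κ, Real.exp (s * (#{u ∈ N | c u = i} - #N / (Fintype.card κ : ℝ))) =
      ∏ u, F u (c u) := by
    intro c
    simp only [hF]
    rw [Finset.prod_ite_mem, Finset.univ_inter, ← Real.exp_sum, ← Finset.mul_sum,
      Finset.sum_sub_distrib, Finset.sum_boole]
    simp [div_eq_mul_inv]
  have h2 : ∑ c : V → κ, ∏ u, F u (c u) = ∏ u, ∑ j, F u j := by
    rw [Finset.prod_univ_sum, Fintype.piFinset_univ]
  have h3 : ∀ u, ∑ j, F u j ≤ Fintype.card κ * (if u ∈ N then Real.exp (s ^ 2) else 1) := by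
    intro u
    by_cases hu : u ∈ N
    · simpa [hF, hu] using sum_exp_indicator_sub_le i hs
    · simp [hF, hu]
  simp only [h1]
  rw [h2]
  calc ∏ u, ∑ j, F u j ≤ ∏ u, (Fintype.card κ * (if u ∈ N then Real.exp (s ^ 2) else 1) : ℝ) := by
        refine Finset.prod_le_prod (fun u _ => Finset.sum_nonneg fun j _ => ?_) fun u _ => h3 u
        simp only [hF]
        split_ifs <;> positivity
    _ = _ := by
      rw [Finset.prod_mul_distrib, Finset.prod_ite_mem, Finset.univ_inter]
      simp [Finset.card_univ, ← Real.exp_nat_mul, mul_comm]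

/-- If `a` is large compared with `√(d log n)`, a regular graph has a vertex colouring for which
every colour appears in every neighbourhood about equally often. -/
theorem SimpleGraph.IsRegularOfDegree.exists_coloring_neighbor_count {V κ : Type*} [Fintype V]
    [DecidableEq V] [Fintype κ] [DecidableEq κ] [Nonempty κ] {G : SimpleGraph V}
    [DecidableRel G.Adj] {d : ℕ} (hG : G.IsRegularOfDegree d) (hd : 0 < d) {a : ℝ} (ha : 0 < a)
    (had : a ≤ 2 * d)
    (h : 4 * d * Real.log (2 * Fintype.card V * Fintype.card κ) ≤ a ^ 2) :
    ∃ c : V → κ, ∀ v i,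
      |(#{u ∈ G.neighborFinset v | c u = i} : ℝ) - d / (Fintype.card κ : ℝ)| ≤ a := by
  rcases isEmpty_or_nonempty V with hV | hV
  · exact ⟨fun v => hV.elim v, fun v => hV.elim v⟩
  have hC : (0 : ℝ) < Fintype.card κ := by exact_mod_cast Fintype.card_pos
  have hn : (0 : ℝ) < Fintype.card V := by exact_mod_cast Fintype.card_pos
  have hd' : (0 : ℝ) < d := by exact_mod_cast hd
  -- This `s` minimises the Chernoff exponent `s² d - s a`; `had` keeps it in the range where the
  -- moment bound holds.
  set s : ℝ := a / (2 * d) with hs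
  have hs0 : 0 < s := by positivity
  have hs1 : |s| ≤ 1 := by
    rw [abs_of_pos hs0, hs, div_le_one (by positivity)]; exact had
  set E : ℝ → (V → κ) → V → κ → ℝ := fun σ c v i =>
    Real.exp (σ * (#{u ∈ G.neighborFinset v | c u = i} - d / (Fintype.card κ : ℝ))) with hE
  have hcard : ∀ v, #(G.neighborFinset v) = d := fun v => hG v
  have key : ∀ σ : ℝ, |σ| ≤ 1 → ∀ v i, ∑ c, E σ c v i ≤
      (Fintype.card κ : ℝ) ^ Fintype.card V * Real.exp (σ ^ 2 * d) := by
    intro σ hσ v i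
    have := sum_colorings_exp_le (G.neighborFinset v) i hσ
    rwa [hcard v] at this
  -- `R` bounds the average over colourings of the sum of all exponentials, over `v`, `i` and both
  -- signs (hence the 2). Some colouring does no worse than average, and then each nonnegative term
  -- is at most `R`.
  set R : ℝ := 2 * Fintype.card V * Fintype.card κ * Real.exp (s ^ 2 * d) with hR
  have htot : ∑ c : V → κ, ∑ v, ∑ i, (E s c v i + E (-s) c v i) ≤ ∑ _c : V → κ, R := by
    rw [Finset.sum_comm]
    have : ∀ v, ∑ c : V → κ, ∑ i, (E s c v i + E (-s) c v i) ≤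
        Fintype.card κ * (2 * ((Fintype.card κ : ℝ) ^ Fintype.card V * Real.exp (s ^ 2 * d))) := by
      intro v
      rw [Finset.sum_comm]
      calc _ ≤ ∑ _i : κ, (2 * ((Fintype.card κ : ℝ) ^ Fintype.card V * Real.exp (s ^ 2 * d))) := by
            refine Finset.sum_le_sum fun i _ => ?_
            rw [Finset.sum_add_distrib]
            have h1 := key s hs1 v i
            have h2 := key (-s) (by rwa [abs_neg]) v i
            rw [neg_sq] at h2
            linarith
        _ = _ := by simp
    calc _ ≤ ∑ _v : V, (Fintype.card κ *
          (2 * ((Fintype.card κ : ℝ) ^ Fintype.card V * Real.exp (s ^ 2 * d)))) :=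
          Finset.sum_le_sum fun v _ => this v
      _ = _ := by
        simp [hR]
        ring
  obtain ⟨c, -, hc⟩ := Finset.exists_le_of_sum_le (Finset.univ_nonempty) htot
  refine ⟨c, fun v i => ?_⟩
  have hpos : ∀ σ v i, 0 ≤ E σ c v i := fun σ v i => (Real.exp_pos _).le
  have hle : E s c v i + E (-s) c v i ≤ R := by
    refine le_trans ?_ hc
    refine le_trans ?_ (Finset.single_le_sum (f := fun v => ∑ i, (E s c v i + E (-s) c v i))
      (fun v _ => Finset.sum_nonneg fun i _ => add_nonneg (hpos _ _ _) (hpos _ _ _))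
      (Finset.mem_univ v))
    exact Finset.single_le_sum (f := fun i => (E s c v i + E (-s) c v i))
      (fun i _ => add_nonneg (hpos _ _ _) (hpos _ _ _)) (Finset.mem_univ i)
  have hRlog : R = Real.exp (Real.log (2 * Fintype.card V * Fintype.card κ) + s ^ 2 * d) := by
    rw [Real.exp_add, Real.exp_log (by positivity)]
  set x : ℝ := #{u ∈ G.neighborFinset v | c u = i} - d / (Fintype.card κ : ℝ) with hx
  have fin : ∀ y : ℝ, s * y ≤ Real.log (2 * Fintype.card V * Fintype.card κ) + s ^ 2 * d →
      y ≤ a := by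
    intro y hy
    have e1 : s * (2 * d) = a := by rw [hs]; field_simp
    have e2 : a * y ≤ a * a := by
      have : 2 * d * (s * y) ≤ 2 * d * (Real.log (2 * Fintype.card V * Fintype.card κ) + s ^ 2 * d) := by
        gcongr
      have e3 : 2 * d * (s * y) = a * y := by rw [← e1]; ring
      have e4 : 2 * d * (s ^ 2 * d) = a ^ 2 / 2 := by rw [← e1]; ring
      nlinarith
    exact le_of_mul_le_mul_left e2 ha
  rw [abs_le]
  constructor
  · have : E (-s) c v i ≤ R := by linarith [hpos s v i]
    rw [hRlog] at this
    have := Real.exp_le_exp.mp this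
    have := fin (-x) (by linarith)
    linarith
  · have : E s c v i ≤ R := by linarith [hpos (-s) v i]
    rw [hRlog] at this
    exact fin x (Real.exp_le_exp.mp this)

/-! ### Spreading residues modulo `M` by minimality and averaging -/

section ResidueSpreading

variable {V : Type*} [Fintype V] [DecidableEq V]

theorem sum_sum_eq_of_symm_pair {g : V → V → ℕ} (hg : ∀ a b, g a b = g b a) {u v : V}
    (huv : u ≠ v) :
    ∑ a, ∑ b, g a b = (∑ a ∈ ({u, v} : Finset V)ᶜ, ∑ b ∈ ({u, v} : Finset V)ᶜ, g a b) +
      2 * (∑ b ∈ ({u, v} : Finset V)ᶜ, (g u b + g v b)) + (g u u + g v v + 2 * g u v) := by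
  have h1 : ∀ f : V → ℕ, ∑ a, f a = (∑ a ∈ ({u, v} : Finset V)ᶜ, f a) + (f u + f v) := by
    intro f
    rw [← Finset.sum_pair huv, Finset.sum_compl_add_sum]
  rw [h1]
  simp only [h1 (g _)]
  rw [Finset.sum_add_distrib, Finset.sum_add_distrib, Finset.sum_add_distrib]
  have h2 : ∀ z, ∑ a ∈ ({u, v} : Finset V)ᶜ, g a z = ∑ a ∈ ({u, v} : Finset V)ᶜ, g z a :=
    fun z => Finset.sum_congr rfl fun a _ => hg a z
  rw [h2 u, h2 v, hg v u]
  ring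

/-- A family of residue assignments in which the residues of the two ends of a pair can be shifted
simultaneously has a member in which no such end has many conflicts with vertices of the same
residue. -/
theorem exists_few_equal_residues {X : Type*} [Finite X] [Nonempty X] {M : ℕ} [NeZero M]
    (ρ : X → V → ZMod M) (conf : V → V → Prop) [DecidableRel conf]
    (hconf : ∀ a b, conf a b → conf b a) {T : ℕ} (hT : ∀ a, #{b | conf a b} ≤ T) :
    ∃ x, ∀ u v, u ≠ v →
      (∀ t, ∃ x', ∀ a, ρ x' a = if a = u ∨ a = v then ρ x a + t else ρ x a) →
      M * #{b | conf u b ∧ ρ x u = ρ x b} ≤ 2 * T + 2 * M := by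
  set g : X → V → V → ℕ := fun x a b => if conf a b ∧ ρ x a = ρ x b then 1 else 0 with hg
  have hgs : ∀ x a b, g x a b = g x b a := by
    intro x a b
    simp only [hg]
    congr 1
    exact propext ⟨fun h => ⟨hconf _ _ h.1, h.2.symm⟩, fun h => ⟨hconf _ _ h.1, h.2.symm⟩⟩
  -- A minimiser of the number of ordered conflicting pairs with equal residues.
  obtain ⟨x, hx⟩ := Finite.exists_min fun x => ∑ a, ∑ b, g x a b
  refine ⟨x, fun u v huv hsh => ?_⟩
  choose y hy using hsh
  set W : Finset V := ({u, v} : Finset V)ᶜ with hW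
  have hWu : ∀ b ∈ W, b ≠ u ∧ b ≠ v := by
    intro b hb
    simpa [hW, not_or] using hb
  -- A common shift of `u` and `v` changes neither the pairs avoiding both nor the pairs inside `{u,
  -- v}`, so minimality compares only the cross terms.
  have hstep : ∀ t, ∑ b ∈ W, (g x u b + g x v b) ≤ ∑ b ∈ W, (g (y t) u b + g (y t) v b) := by
    intro t
    have h := hx (y t)
    rw [sum_sum_eq_of_symm_pair (hgs x) huv, sum_sum_eq_of_symm_pair (hgs (y t)) huv] at h
    have h1 : ∑ a ∈ W, ∑ b ∈ W, g (y t) a b = ∑ a ∈ W, ∑ b ∈ W, g x a b := by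
      refine Finset.sum_congr rfl fun a ha => Finset.sum_congr rfl fun b hb => ?_
      have ha' := hWu a ha
      have hb' := hWu b hb
      simp [hg, hy, ha', hb']
    have h2 : g (y t) u u = g x u u := by simp [hg, hy]
    have h3 : g (y t) v v = g x v v := by simp [hg, hy]
    have h4 : g (y t) u v = g x u v := by simp [hg, hy]
    rw [← hW, h1, h2, h3, h4] at h
    omega
  -- As `t` runs over `ZMod M`, each conflicting `b` outside the pair meets the residue of `z` for
  -- exactly one `t`.
  have hsum : ∀ z, z = u ∨ z = v → ∑ t : ZMod M, ∑ b ∈ W, g (y t) z b ≤ T := by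
    intro z hz
    rw [Finset.sum_comm]
    calc ∑ b ∈ W, ∑ t : ZMod M, g (y t) z b ≤ ∑ b ∈ W, if conf z b then 1 else 0 := by
          refine Finset.sum_le_sum fun b hb => ?_
          have hb' := hWu b hb
          by_cases hc : conf z b
          · have : ∀ t, g (y t) z b = if t = ρ x b - ρ x z then 1 else 0 := by
              intro t
              simp only [hg, hy, hc, hb', hz, true_and, or_self, if_true, if_false]
              congr 1
              rw [eq_sub_iff_add_eq, add_comm]
            simp [this, hc]
          · simp [hg, hc]
      _ ≤ ∑ b, if conf z b then 1 else 0 :=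
          Finset.sum_le_sum_of_subset (Finset.subset_univ _)
      _ ≤ T := by simpa using hT z
  have hM : M * ∑ b ∈ W, g x u b ≤ 2 * T := by
    calc M * ∑ b ∈ W, g x u b ≤ M * ∑ b ∈ W, (g x u b + g x v b) := by
          gcongr with b hb
          omega
      _ = ∑ _t : ZMod M, ∑ b ∈ W, (g x u b + g x v b) := by
          simp [ZMod.card]
      _ ≤ ∑ t : ZMod M, ∑ b ∈ W, (g (y t) u b + g (y t) v b) :=
          Finset.sum_le_sum fun t _ => hstep t
      _ = (∑ t : ZMod M, ∑ b ∈ W, g (y t) u b) + ∑ t : ZMod M, ∑ b ∈ W, g (y t) v b := by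
          simp only [Finset.sum_add_distrib]
      _ ≤ 2 * T := by
          have := hsum u (Or.inl rfl)
          have := hsum v (Or.inr rfl)
          omega
  -- The 2 accounts for `b = u` and `b = v`, which `W` omits.
  have hcard : #{b | conf u b ∧ ρ x u = ρ x b} ≤ (∑ b ∈ W, g x u b) + 2 := by
    rw [Finset.card_filter]
    have : ∑ b, g x u b = (∑ b ∈ W, g x u b) + (g x u u + g x u v) := by
      rw [← Finset.sum_pair huv, Finset.sum_compl_add_sum]
    have h1 : g x u u ≤ 1 := by simp only [hg]; split_ifs <;> simp
    have h2 : g x u v ≤ 1 := by simp only [hg]; split_ifs <;> simp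
    change ∑ b, g x u b ≤ _
    omega
  calc M * #{b | conf u b ∧ ρ x u = ρ x b} ≤ M * ((∑ b ∈ W, g x u b) + 2) := by gcongr
    _ ≤ _ := by rw [mul_add]; omega

/-- Edge shifts in `[0, M)` after which no non-isolated vertex has many conflicts with vertices
whose weight has the same residue modulo `M`. -/
theorem SimpleGraph.exists_shift_few_equal_residues (Γ : SimpleGraph V) [DecidableRel Γ.Adj]
    {M : ℕ} (hM : 0 < M) (w : V → ℤ) (conf : V → V → Prop) [DecidableRel conf]
    (hconf : ∀ a b, conf a b → conf b a) {T : ℕ} (hT : ∀ a, #{b | conf a b} ≤ T) :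
    ∃ f : V → V → ℤ, (∀ a b, f a b = f b a) ∧ (∀ a b, ¬ Γ.Adj a b → f a b = 0) ∧
      (∀ a b, 0 ≤ f a b ∧ f a b < M) ∧
      ∀ u, (∃ v, Γ.Adj u v) →
        M * #{b | conf u b ∧ (w u + ∑ z, f u z) % M = (w b + ∑ z, f b z) % M} ≤ 2 * T + 2 * M := by
  have : NeZero M := ⟨hM.ne'⟩
  set F : (Sym2 V → ZMod M) → V → V → ℤ := fun x a b => if Γ.Adj a b then ((x s(a, b)).val : ℤ) else 0
    with hF
  set ρ : (Sym2 V → ZMod M) → V → ZMod M := fun x a => ((w a + ∑ z, F x a z : ℤ) : ZMod M) with hρ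
  have hFc : ∀ x a b, ((F x a b : ℤ) : ZMod M) = if Γ.Adj a b then x s(a, b) else 0 := by
    intro x a b
    simp only [hF]
    split_ifs <;> simp
  obtain ⟨x, hx⟩ := exists_few_equal_residues ρ conf hconf hT
  refine ⟨F x, ?_, ?_, ?_, ?_⟩
  · intro a b
    simp only [hF, Γ.adj_comm a b, Sym2.eq_swap (a := a)]
  · intro a b hab
    simp [hF, hab]
  · intro a b
    simp only [hF]
    split_ifs
    · exact ⟨by positivity, by exact_mod_cast ZMod.val_lt _⟩
    · exact ⟨le_rfl, by exact_mod_cast hM⟩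
  · rintro u ⟨v, huv⟩
    have h := hx u v huv.ne ?_
    · convert h using 4
      rename_i b _
      simp only [hρ]
      rw [ZMod.intCast_eq_intCast_iff]
      rfl
    · intro t
      -- Adding `t` to the value on the edge `uv` shifts the residues of its two ends by `t` and no
      -- others.
      refine ⟨Function.update x s(u, v) (x s(u, v) + t), fun a => ?_⟩
      have hdiff : ∀ a z, ((F (Function.update x s(u, v) (x s(u, v) + t)) a z : ℤ) : ZMod M) =
          (F x a z : ℤ) + if s(a, z) = s(u, v) then t else 0 := by
        intro a z
        rw [hFc, hFc]
        by_cases he : s(a, z) = s(u, v)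
        · have hadj : Γ.Adj a z := by
            rw [← SimpleGraph.mem_edgeSet, he, SimpleGraph.mem_edgeSet]; exact huv
          simp [hadj, he]
        · simp [he]
      simp only [hρ]
      push_cast
      simp only [hdiff]
      rw [Finset.sum_add_distrib, ← add_assoc]
      have hne := huv.ne
      by_cases hau : a = u
      · subst hau
        have : ∀ z, (s(a, z) = s(a, v)) ↔ z = v := fun z => Sym2.congr_right
        simp [this]
      · by_cases hav : a = v
        · subst hav
          have : ∀ z, (s(a, z) = s(u, a)) ↔ z = u := by
            intro z; rw [Sym2.eq_swap (a := u), Sym2.congr_right]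
          simp [this]
        · have : ∀ z, ¬ (s(a, z) = s(u, v)) := by
            intro z; simp [hau, hav]
          simp [this, hau, hav]

end ResidueSpreading

/-! ### Greedy separation of indices in a bipartite graph -/

section Greedy

/-- Among `D + 1` consecutive integers, more than `t` shift `c` to a multiple of `m` when
`t < (D + 1) / m`. -/
theorem exists_dvd_add_notMem {D m : ℕ} (hm : 0 < m) (c l : ℤ) (A : Finset ℤ)
    (hA : #A < (D + 1) / m) :
    ∃ j, l ≤ j ∧ j ≤ l + D ∧ (m : ℤ) ∣ c + j ∧ c + j ∉ A := by
  have hm' : (0 : ℤ) < m := by exact_mod_cast hm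
  -- The least shift from `l` on that reaches a multiple of `m`. Since `j₀ < l + m`, steps of `m`
  -- from it give `(D + 1) / m` candidates in the range.
  set j₀ : ℤ := l + (-(c + l)) % m with hj₀
  have hdvd : (m : ℤ) ∣ c + j₀ := by
    rw [hj₀, ← add_assoc, Int.dvd_iff_emod_eq_zero, Int.add_emod_emod]
    simp
  have hj1 : l ≤ j₀ := by
    have := Int.emod_nonneg (-(c + l)) hm'.ne'
    omega
  have hj2 : j₀ < l + m := by
    have := Int.emod_lt_of_pos (-(c + l)) hm'
    omega
  set I : Finset ℤ := (Finset.range ((D + 1) / m)).image fun i : ℕ => c + j₀ + m * i with hI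
  have hcard : #I = (D + 1) / m := by
    rw [hI, Finset.card_image_of_injective, Finset.card_range]
    intro a b hab
    simp only [add_right_inj, mul_eq_mul_left_iff, Nat.cast_inj] at hab
    rcases hab with h | h
    · exact h
    · omega
  obtain ⟨x, hxI, hxA⟩ := Finset.exists_mem_notMem_of_card_lt_card (hcard ▸ hA)
  simp only [hI, Finset.mem_image, Finset.mem_range] at hxI
  obtain ⟨i, hi, rfl⟩ := hxI
  have hmi : (0 : ℤ) ≤ m * i := by positivity
  refine ⟨j₀ + m * i, by omega, ?_, ?_, ?_⟩
  · have h1 : m * (i + 1) ≤ D + 1 :=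
      (Nat.mul_le_mul_left m hi).trans (Nat.mul_div_le (D + 1) m)
    have h2 : (m : ℤ) * i + m ≤ D + 1 := by exact_mod_cast h1
    omega
  · rw [← add_assoc]
    exact dvd_add hdvd (dvd_mul_right _ _)
  · rw [← add_assoc]
    exact hxA

variable {V : Type*} [DecidableEq V]

/-- The symmetric function with value `ε` on the pairs joining `q` to a vertex of `B`. -/
def starShift (q : V) (B : Finset V) (ε : ℤ) (a b : V) : ℤ :=
  ε * ((if a = q ∧ b ∈ B then 1 else 0) + if b = q ∧ a ∈ B then 1 else 0)

theorem starShift_comm (q : V) (B : Finset V) (ε : ℤ) (a b : V) :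
    starShift q B ε a b = starShift q B ε b a := by
  unfold starShift
  rw [add_comm]

theorem sum_starShift [Fintype V] (q : V) (B : Finset V) (ε : ℤ) (a : V) :
    ∑ b, starShift q B ε a b = ε * ((if a = q then (#B : ℤ) else 0) + if a ∈ B then 1 else 0) := by
  unfold starShift
  rw [← Finset.mul_sum, Finset.sum_add_distrib]
  congr 2
  · by_cases h : a = q <;> simp [h]
  · by_cases h : a ∈ B <;> simp [h]

theorem starShift_eq_zero {q : V} {B : Finset V} {ε : ℤ} {a b : V} (h₁ : ¬ (a = q ∧ b ∈ B))
    (h₂ : ¬ (b = q ∧ a ∈ B)) : starShift q B ε a b = 0 := by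
  simp [starShift, h₁, h₂]

/-- In a graph with parts `P` and `Q`, the indices of the vertices in `P` can be made multiples of
`m`, distinct for conflicting vertices, by raising some edges by one. -/
theorem exists_first_part_shift [Fintype V] (Γ : SimpleGraph V) [DecidableRel Γ.Adj] (P Q : Finset V)
    (hPQ : Disjoint P Q) (hΓ : ∀ a b, Γ.Adj a b → (a ∈ P ∧ b ∈ Q) ∨ (a ∈ Q ∧ b ∈ P)) {D m t : ℕ}
    (hm : 0 < m) (hdeg : ∀ p ∈ P, D ≤ #(Γ.neighborFinset p)) (κ : V → V → Prop) [DecidableRel κ]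
    (hκ : ∀ a b, κ a b → κ b a) (ht : ∀ a ∈ P, #{b | κ a b} ≤ t) (htD : t < (D + 1) / m)
    (idx : V → ℤ) (A : Finset V) (hA : A ⊆ P) :
    ∃ f : V → V → ℤ, (∀ a b, f a b = f b a) ∧ (∀ a b, f a b ≠ 0 → Γ.Adj a b ∧ (a ∈ A ∨ b ∈ A)) ∧
      (∀ a b, 0 ≤ f a b ∧ f a b ≤ 1) ∧ (∀ a ∈ A, (m : ℤ) ∣ idx a + ∑ b, f a b) ∧
      ∀ a ∈ A, ∀ b ∈ A, a ≠ b → κ a b → idx a + ∑ z, f a z ≠ idx b + ∑ z, f b z := by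
  induction A using Finset.induction_on with
  | empty => exact ⟨fun _ _ => 0, by simp⟩
  | insert p A hpA ih =>
    obtain ⟨f, hsym, hsupp, hf01, hdvd, hdist⟩ := ih ((Finset.subset_insert _ _).trans hA)
    have hpP : p ∈ P := hA (Finset.mem_insert_self _ _)
    have hAP : A ⊆ P := (Finset.subset_insert _ _).trans hA
    have hnot : ∀ {v}, v ∈ P → v ∉ Q := fun hv hv' => (Finset.disjoint_left.mp hPQ) hv hv'
    -- Edges changed so far have an end in `A ⊆ P`, while the neighbours of `p` lie in `Q`; so the
    -- edges at `p` are untouched and can each be raised once.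
    have hfp : ∀ b, f p b = 0 := by
      intro b
      by_contra hne
      obtain ⟨hadj, h | h⟩ := hsupp p b hne
      · exact hpA h
      · rcases hΓ p b hadj with ⟨-, h'⟩ | ⟨h', -⟩
        · exact hnot (hAP h) h'
        · exact hnot hpP h'
    set forb : Finset ℤ := ({b | κ p b} : Finset V).image fun b => idx b + ∑ z, f b z with hforb
    obtain ⟨j, hj0, hjD, hjm, hjf⟩ := exists_dvd_add_notMem (D := D) hm (idx p) 0 forb
      ((Finset.card_image_le.trans (ht p hpP)).trans_lt htD)
    obtain ⟨B, hBN, hBj⟩ := Finset.exists_subset_card_eq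
      (show j.toNat ≤ #(Γ.neighborFinset p) from le_trans (by omega) (hdeg p hpP))
    have hBj' : (#B : ℤ) = j := by omega
    have hBadj : ∀ {b}, b ∈ B → Γ.Adj p b := fun hb => by
      simpa using hBN hb
    have hBP : ∀ {b}, b ∈ B → b ∉ P := fun hb hP => by
      rcases hΓ _ _ (hBadj hb) with ⟨-, h'⟩ | ⟨h', -⟩
      · exact hnot hP h'
      · exact hnot hpP h'
    have hsum : ∀ a ∈ P, ∑ b, (f a b + starShift p B 1 a b) =
        (∑ b, f a b) + if a = p then j else 0 := by
      intro a ha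
      have : a ∉ B := fun h => hBP h ha
      rw [Finset.sum_add_distrib, sum_starShift, hBj']
      simp [this]
    have hsump : ∑ b, f p b = 0 := by simp [hfp]
    have hval : ∀ a ∈ A, idx a + ∑ b, (f a b + starShift p B 1 a b) = idx a + ∑ b, f a b := by
      intro a ha
      have : a ≠ p := fun h => hpA (h ▸ ha)
      rw [hsum a (hAP ha)]
      simp [this]
    have hvalp : idx p + ∑ b, (f p b + starShift p B 1 p b) = idx p + j := by
      rw [hsum p hpP, hsump]
      simp
    have hnew : ∀ a ∈ A, κ p a → idx p + j ≠ idx a + ∑ b, f a b := by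
      intro a _ hκa he
      apply hjf
      rw [hforb, he]
      exact Finset.mem_image_of_mem _ (by simpa using hκa)
    refine ⟨fun a b => f a b + starShift p B 1 a b, ?_, ?_, ?_, ?_, ?_⟩ <;> beta_reduce
    · intro a b
      rw [hsym, starShift_comm]
    · intro a b hne
      by_cases h1 : f a b = 0
      · by_cases h2 : a = p ∧ b ∈ B
        · rw [h2.1]
          exact ⟨hBadj h2.2, Or.inl (Finset.mem_insert_self _ _)⟩
        · by_cases h3 : b = p ∧ a ∈ B
          · rw [h3.1]
            exact ⟨(hBadj h3.2).symm, Or.inr (Finset.mem_insert_self _ _)⟩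
          · exact absurd (by rw [h1, starShift_eq_zero h2 h3, add_zero]) hne
      · obtain ⟨h2, h3⟩ := hsupp a b h1
        exact ⟨h2, h3.imp (Finset.mem_insert_of_mem) (Finset.mem_insert_of_mem)⟩
    · intro a b
      by_cases h2 : a = p ∧ b ∈ B
      · have h3 : ¬ (b = p ∧ a ∈ B) := fun h => hBP (h.1 ▸ h2.2) hpP
        have hpB : p ∉ B := fun h => hBP h hpP
        rw [h2.1, hfp]
        simp [starShift, h2.2, hpB]
      · by_cases h3 : b = p ∧ a ∈ B
        · have : f a b = 0 := by rw [h3.1, hsym, hfp]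
          have hpB : p ∉ B := fun h => hBP h hpP
          rw [this]
          simp [starShift, h3, hpB]
        · rw [starShift_eq_zero h2 h3, add_zero]
          exact hf01 a b
    · intro a ha
      rcases Finset.mem_insert.mp ha with rfl | ha
      · rw [hvalp]; exact hjm
      · rw [hval a ha]; exact hdvd a ha
    · intro a ha b hb hab hκab
      rcases Finset.mem_insert.mp ha with rfl | ha' <;> rcases Finset.mem_insert.mp hb with rfl | hb'
      · exact absurd rfl hab
      · rw [hvalp, hval b hb']; exact hnew b hb' hκab
      · rw [hvalp, hval a ha']; exact (hnew a ha' (hκ _ _ hκab)).symm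
      · rw [hval a ha', hval b hb']; exact hdist a ha' b hb' hab hκab

/-- In a graph with parts `P` and `Q`, the indices of the vertices in `Q` can be made multiples of
`m`, distinct from those of the conflicting vertices, while those in `P` are kept or raised by one.
-/
theorem exists_second_part_shift [Fintype V] (Γ : SimpleGraph V) [DecidableRel Γ.Adj] (P Q : Finset V)
    (hPQ : Disjoint P Q) (hΓ : ∀ a b, Γ.Adj a b → (a ∈ P ∧ b ∈ Q) ∨ (a ∈ Q ∧ b ∈ P)) {D m t : ℕ}
    (hm : 0 < m) (hdeg : ∀ q ∈ Q, D ≤ #(Γ.neighborFinset q)) (κ : V → V → Prop) [DecidableRel κ]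
    (hκ : ∀ a b, κ a b → κ b a) (ht : ∀ a ∈ Q, #{b | κ a b} ≤ t) (htD : t < (D + 1) / m)
    (idx : V → ℤ) (A : Finset V) (hA : A ⊆ Q) :
    ∃ f : V → V → ℤ, (∀ a b, f a b = f b a) ∧ (∀ a b, f a b ≠ 0 → Γ.Adj a b ∧ (a ∈ A ∨ b ∈ A)) ∧
      (∀ a b, |f a b| ≤ 1) ∧ (∀ p ∈ P, ∑ b, f p b = 0 ∨ ∑ b, f p b = 1) ∧
      (∀ a ∈ A, (m : ℤ) ∣ idx a + ∑ b, f a b) ∧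
      (∀ a ∈ A, ∀ b ∈ A, a ≠ b → κ a b → idx a + ∑ z, f a z ≠ idx b + ∑ z, f b z) ∧
      ∀ a ∈ A, ∀ b ∈ P, κ a b → idx a + ∑ z, f a z ≠ idx b := by
  induction A using Finset.induction_on with
  | empty => exact ⟨fun _ _ => 0, by simp⟩
  | insert q A hqA ih =>
    obtain ⟨f, hsym, hsupp, hf1, hP01, hdvd, hdist, hdistP⟩ :=
      ih ((Finset.subset_insert _ _).trans hA)
    have hqQ : q ∈ Q := hA (Finset.mem_insert_self _ _)
    have hAQ : A ⊆ Q := (Finset.subset_insert _ _).trans hA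
    have hnot : ∀ {v}, v ∈ P → v ∉ Q := fun hv hv' => (Finset.disjoint_left.mp hPQ) hv hv'
    have hfq : ∀ b, f q b = 0 := by
      intro b
      by_contra hne
      obtain ⟨hadj, h | h⟩ := hsupp q b hne
      · exact hqA h
      · rcases hΓ q b hadj with ⟨h', -⟩ | ⟨-, h'⟩
        · exact hnot h' hqQ
        · exact hnot h' (hAQ h)
    have hNP : ∀ {b}, b ∈ Γ.neighborFinset q → b ∈ P := fun hb => by
      rcases hΓ q _ (by simpa using hb) with ⟨h', -⟩ | ⟨-, h'⟩
      · exact absurd hqQ (hnot h')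
      · exact h'
    -- A vertex of `P` has accumulated shift 0 or 1. Raising edges to those with 0, or lowering
    -- edges to those with 1, keeps this true and moves the index of `q` by any `j` from `-#N₁` to
    -- `#N₀`, at least `D + 1` values.
    set N₀ : Finset V := {b ∈ Γ.neighborFinset q | ∑ z, f b z = 0} with hN₀
    set N₁ : Finset V := {b ∈ Γ.neighborFinset q | ¬ ∑ z, f b z = 0} with hN₁
    have hN : #N₀ + #N₁ = #(Γ.neighborFinset q) := Finset.card_filter_add_card_filter_not _
    -- For `b ∈ P` the value to avoid is the lower admissible index `idx b`, whatever its current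
    -- shift.
    set forb : Finset ℤ := ({b | κ q b} : Finset V).image
      fun b => if b ∈ P then idx b else idx b + ∑ z, f b z with hforb
    obtain ⟨j, hj0, hjD, hjm, hjf⟩ := exists_dvd_add_notMem (D := D) hm (idx q) (-#N₁) forb
      ((Finset.card_image_le.trans (ht q hqQ)).trans_lt htD)
    have hD := hdeg q hqQ
    have hB : ∃ (ε : ℤ) (B : Finset V), ε * #B = j ∧ |ε| ≤ 1 ∧ (∀ b ∈ B, Γ.Adj q b) ∧
        ∀ b ∈ B, (∑ z, f b z) + ε = 0 ∨ (∑ z, f b z) + ε = 1 := by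
      rcases le_total 0 j with hj | hj
      · obtain ⟨B, hBN, hBj⟩ := Finset.exists_subset_card_eq (show j.toNat ≤ #N₀ by omega)
        refine ⟨1, B, by omega, by simp, fun b hb => ?_, fun b hb => ?_⟩
        · simpa using (Finset.mem_filter.mp (hBN hb)).1
        · rw [(Finset.mem_filter.mp (hBN hb)).2]
          simp
      · obtain ⟨B, hBN, hBj⟩ := Finset.exists_subset_card_eq (show (-j).toNat ≤ #N₁ by omega)
        refine ⟨-1, B, by omega, by simp, fun b hb => ?_, fun b hb => ?_⟩
        · simpa using (Finset.mem_filter.mp (hBN hb)).1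
        · have h := Finset.mem_filter.mp (hBN hb)
          rw [(hP01 b (hNP h.1)).resolve_left h.2]
          simp
    obtain ⟨ε, B, hBj, hε, hBadj, hBval⟩ := hB
    have hBP : ∀ {b}, b ∈ B → b ∈ P := fun hb => hNP (by simpa using hBadj _ hb)
    have hsum : ∀ a, ∑ b, (f a b + starShift q B ε a b) =
        (∑ b, f a b) + ((if a = q then j else 0) + if a ∈ B then ε else 0) := by
      intro a
      rw [Finset.sum_add_distrib, sum_starShift, mul_add, ← hBj]
      simp only [mul_ite, mul_one, mul_zero]
    have hsumq : ∑ b, f q b = 0 := by simp [hfq]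
    have hQB : ∀ {a}, a ∈ Q → a ∉ B := fun ha hB => hnot (hBP hB) ha
    have hval : ∀ a ∈ A, idx a + ∑ b, (f a b + starShift q B ε a b) = idx a + ∑ b, f a b := by
      intro a ha
      have h1 : a ≠ q := fun h => hqA (h ▸ ha)
      rw [hsum a]
      simp [h1, hQB (hAQ ha)]
    have hvalq : idx q + ∑ b, (f q b + starShift q B ε q b) = idx q + j := by
      rw [hsum q, hsumq]
      simp [hQB hqQ]
    have hnew : ∀ a ∈ A, κ q a → idx q + j ≠ idx a + ∑ b, f a b := by
      intro a ha hκa he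
      apply hjf
      rw [hforb, he, Finset.mem_image]
      refine ⟨a, by simpa using hκa, ?_⟩
      rw [if_neg fun h => hnot h (hAQ ha)]
    have hnewP : ∀ a ∈ P, κ q a → idx q + j ≠ idx a := by
      intro a ha hκa he
      apply hjf
      rw [hforb, he, Finset.mem_image]
      exact ⟨a, by simpa using hκa, if_pos ha⟩
    refine ⟨fun a b => f a b + starShift q B ε a b, ?_, ?_, ?_, ?_, ?_, ?_, ?_⟩ <;> beta_reduce
    · intro a b
      rw [hsym, starShift_comm]
    · intro a b hne
      by_cases h1 : f a b = 0
      · by_cases h2 : a = q ∧ b ∈ B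
        · rw [h2.1]
          exact ⟨hBadj _ h2.2, Or.inl (Finset.mem_insert_self _ _)⟩
        · by_cases h3 : b = q ∧ a ∈ B
          · rw [h3.1]
            exact ⟨(hBadj _ h3.2).symm, Or.inr (Finset.mem_insert_self _ _)⟩
          · exact absurd (by rw [h1, starShift_eq_zero h2 h3, add_zero]) hne
      · obtain ⟨h2, h3⟩ := hsupp a b h1
        exact ⟨h2, h3.imp (Finset.mem_insert_of_mem) (Finset.mem_insert_of_mem)⟩
    · intro a b
      have hqB : q ∉ B := hQB hqQ
      by_cases h2 : a = q ∧ b ∈ B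
      · have h3 : ¬ (b = q ∧ a ∈ B) := fun h => hqB (h.1 ▸ h2.2)
        rw [h2.1, hfq]
        simpa [starShift, h2, hqB] using hε
      · by_cases h3 : b = q ∧ a ∈ B
        · have : f a b = 0 := by rw [h3.1, hsym, hfq]
          rw [this]
          simpa [starShift, h2, h3, hqB] using hε
        · rw [starShift_eq_zero h2 h3, add_zero]
          exact hf1 a b
    · intro p hp
      have hpq : p ≠ q := fun h => hnot hp (h ▸ hqQ)
      rw [hsum p, if_neg hpq, zero_add]
      by_cases hpB : p ∈ B
      · rw [if_pos hpB]; exact hBval p hpB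
      · rw [if_neg hpB, add_zero]; exact hP01 p hp
    · intro a ha
      rcases Finset.mem_insert.mp ha with rfl | ha
      · rw [hvalq]; exact hjm
      · rw [hval a ha]; exact hdvd a ha
    · intro a ha b hb hab hκab
      rcases Finset.mem_insert.mp ha with rfl | ha' <;> rcases Finset.mem_insert.mp hb with rfl | hb'
      · exact absurd rfl hab
      · rw [hvalq, hval b hb']; exact hnew b hb' hκab
      · rw [hvalq, hval a ha']; exact (hnew a ha' (hκ _ _ hκab)).symm
      · rw [hval a ha', hval b hb']; exact hdist a ha' b hb' hab hκab
    · intro a ha b hb hκab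
      rcases Finset.mem_insert.mp ha with rfl | ha'
      · rw [hvalq]; exact hnewP b hb hκab
      · rw [hval a ha']; exact hdistP a ha' b hb hκab

end Greedy

/-! ### Combining residues and quotients modulo `M` -/

section Adjustment

variable {V : Type*} [Fintype V] [DecidableEq V]

/-- In a graph with parts `P` and `Q` and large minimum degree, edge shifts of size at most `3 * M`
make the vertex weights distinct for conflicting vertices, and bring `⌊weight / M⌋` to the residues
`0` and `1` modulo `m`. -/
theorem SimpleGraph.exists_bipartite_adjustment (Γ : SimpleGraph V) [DecidableRel Γ.Adj]
    (P Q : Finset V) (hPQ : Disjoint P Q)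
    (hΓ : ∀ a b, Γ.Adj a b → (a ∈ P ∧ b ∈ Q) ∨ (a ∈ Q ∧ b ∈ P)) {D m T M : ℕ} (hm : 2 ≤ m)
    (hM : 0 < M) (hdeg : ∀ v, v ∈ P ∨ v ∈ Q → D ≤ #(Γ.neighborFinset v))
    (conf : V → V → Prop) [DecidableRel conf] (hconf : ∀ a b, conf a b → conf b a)
    (hT : ∀ a, #{b | conf a b} ≤ T) (hTD : 2 * T + 2 * M < M * ((D + 1) / m)) (w : V → ℤ) :
    ∃ f : V → V → ℤ, (∀ a b, f a b = f b a) ∧ (∀ a b, ¬ Γ.Adj a b → f a b = 0) ∧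
      (∀ a b, |f a b| ≤ 3 * M) ∧
      (∀ v, v ∈ P ∨ v ∈ Q → (w v + ∑ z, f v z) / M % m = 0 ∨ (w v + ∑ z, f v z) / M % m = 1) ∧
      ∀ a b, a ∈ P ∨ a ∈ Q → b ∈ P ∨ b ∈ Q → a ≠ b → conf a b →
        w a + ∑ z, f a z ≠ w b + ∑ z, f b z := by
  obtain ⟨x, hxs, hx0, hxM, hxr⟩ := Γ.exists_shift_few_equal_residues hM w conf hconf hT
  set w' : V → ℤ := fun v => w v + ∑ z, x v z with hw'
  -- All later changes are multiples of `M` and preserve residues, so only conflicting vertices with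
  -- equal residues can still collide.
  set κ : V → V → Prop := fun a b => conf a b ∧ w' a % M = w' b % M with hκdef
  set t : ℕ := (2 * T + 2 * M) / M with ht
  have hM' : (0 : ℤ) < M := by exact_mod_cast hM
  have htD : t < (D + 1) / m := by
    rw [ht, Nat.div_lt_iff_lt_mul hM]
    exact hTD.trans_eq (mul_comm _ _)
  -- For `D = 0` the quotient `1 / m` would vanish. Positivity of `D` makes the vertices of `P` and
  -- `Q` non-isolated, as the residue bound requires.
  have hD : 0 < D := by
    rcases Nat.eq_zero_or_pos D with h | h
    · rw [h, zero_add, Nat.div_eq_of_lt (by omega : 1 < m)] at htD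
      exact absurd htD (Nat.not_lt_zero _)
    · exact h
  have hκ : ∀ a b, κ a b → κ b a := fun a b h => ⟨hconf _ _ h.1, h.2.symm⟩
  have hκt : ∀ v, v ∈ P ∨ v ∈ Q → #{b | κ v b} ≤ t := by
    intro v hv
    rw [ht, Nat.le_div_iff_mul_le hM, mul_comm]
    obtain ⟨z, hz⟩ := Finset.card_pos.mp (hD.trans_le (hdeg v hv))
    exact hxr v ⟨z, by simpa using hz⟩
  set idx : V → ℤ := fun v => w' v / M with hidx
  obtain ⟨f, hfs, hfsupp, hf01, hfdvd, hfd⟩ := exists_first_part_shift Γ P Q hPQ hΓ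
    (by omega : 0 < m) (fun p hp => hdeg p (Or.inl hp)) κ hκ (fun a ha => hκt a (Or.inl ha)) htD idx
    P subset_rfl
  obtain ⟨g, hgs, hgsupp, hg1, hgP, hgdvd, hgd, hgdP⟩ := exists_second_part_shift Γ P Q hPQ hΓ
    (by omega : 0 < m) (fun p hp => hdeg p (Or.inr hp)) κ hκ (fun a ha => hκt a (Or.inr ha)) htD
    (fun v => idx v + ∑ z, f v z) Q subset_rfl
  set F : V → V → ℤ := fun a b => x a b + M * (f a b + g a b) with hF
  set J : V → ℤ := fun v => idx v + ∑ z, f v z + ∑ z, g v z with hJ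
  have hW : ∀ v, w v + ∑ z, F v z = w' v % M + M * J v := by
    intro v
    simp only [hF, hJ, Finset.sum_add_distrib, ← Finset.mul_sum]
    have h1 := Int.emod_add_mul_ediv (w' v) M
    have h2 : w' v = w v + ∑ z, x v z := rfl
    have h3 : idx v = w' v / M := rfl
    rw [h3, mul_add, mul_add, mul_add]
    linarith
  have hWdiv : ∀ v, (w v + ∑ z, F v z) / M = J v := by
    intro v
    rw [hW, Int.add_mul_ediv_left _ _ hM'.ne',
      Int.ediv_eq_zero_of_lt (Int.emod_nonneg _ hM'.ne') (Int.emod_lt_of_pos _ hM'), zero_add]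
  have hWmod : ∀ v, (w v + ∑ z, F v z) % M = w' v % M := by
    intro v
    rw [hW, Int.add_mul_emod_self_left, Int.emod_emod]
  -- the lower of the two admissible indices
  obtain ⟨y, hydvd, hyJ, hyd⟩ : ∃ y : V → ℤ, (∀ v, v ∈ P ∨ v ∈ Q → (m : ℤ) ∣ y v) ∧
      (∀ v, v ∈ P ∨ v ∈ Q → J v = y v ∨ J v = y v + 1) ∧
      ∀ a b, a ∈ P ∨ a ∈ Q → b ∈ P ∨ b ∈ Q → a ≠ b → κ a b → y a ≠ y b := by
    have hnot : ∀ {v}, v ∈ Q → v ∉ P := fun hv hv' => (Finset.disjoint_left.mp hPQ) hv' hv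
    refine ⟨fun v => if v ∈ P then idx v + ∑ z, f v z else J v, ?_, ?_, ?_⟩ <;> beta_reduce
    · rintro v (hv | hv)
      · rw [if_pos hv]; exact hfdvd v hv
      · rw [if_neg (hnot hv)]; exact hgdvd v hv
    · rintro v (hv | hv)
      · rw [if_pos hv]
        rcases hgP v hv with h | h
        · left; simp only [hJ]; rw [h, add_zero]
        · right; simp only [hJ]; rw [h]
      · rw [if_neg (hnot hv)]; exact Or.inl rfl
    · rintro a b (ha | ha) (hb | hb) hab hκab
      · rw [if_pos ha, if_pos hb]; exact hfd a ha b hb hab hκab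
      · rw [if_pos ha, if_neg (hnot hb)]; exact (hgdP b hb a ha (hκ _ _ hκab)).symm
      · rw [if_neg (hnot ha), if_pos hb]; exact hgdP a ha b hb hκab
      · rw [if_neg (hnot ha), if_neg (hnot hb)]; exact hgd a ha b hb hab hκab
  have hm' : (2 : ℤ) ≤ m := by exact_mod_cast hm
  refine ⟨F, ?_, ?_, ?_, ?_, ?_⟩
  · intro a b
    simp only [hF, hxs a b, hfs a b, hgs a b]
  · intro a b hab
    have h1 : f a b = 0 := by
      by_contra h; exact hab (hfsupp a b h).1
    have h2 : g a b = 0 := by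
      by_contra h; exact hab (hgsupp a b h).1
    simp [hF, hx0 a b hab, h1, h2]
  · intro a b
    obtain ⟨h1, h2⟩ := hxM a b
    obtain ⟨h3, h4⟩ := hf01 a b
    obtain ⟨h5, h6⟩ := abs_le.mp (hg1 a b)
    rw [abs_le]
    simp only [hF]
    constructor <;> nlinarith
  · intro v hv
    rw [hWdiv]
    rcases hyJ v hv with h | h
    · left; rw [h]; exact Int.emod_eq_zero_of_dvd (hydvd v hv)
    · right
      rw [h, Int.add_emod, Int.emod_eq_zero_of_dvd (hydvd v hv), zero_add, Int.emod_emod,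
        Int.emod_eq_of_lt (by norm_num) (by omega)]
  · intro a b ha hb hab hc he
    have hκab : κ a b := ⟨hc, by rw [← hWmod, ← hWmod, he]⟩
    have hJJ : J a = J b := by rw [← hWdiv, ← hWdiv, he]
    have hne := hyd a b ha hb hab hκab
    -- Equal indices force `y a` and `y b` to differ by at most 1; being multiples of `m ≥ 2`, they
    -- would coincide.
    have hdv : (m : ℤ) ∣ y a - y b := dvd_sub (hydvd a ha) (hydvd b hb)
    have h1 : |y a - y b| < m := by
      rw [abs_lt]
      rcases hyJ a ha with h | h <;> rcases hyJ b hb with h' | h' <;> constructor <;> omega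
    have := Int.eq_zero_of_abs_lt_dvd hdv h1
    omega

end Adjustment

/-! ### Shares of corrections and choice of targets -/

/-- An integer of absolute value at most `σ * #A` can be distributed over `A` with shares of
absolute value at most `σ`. -/
theorem exists_bounded_shares {V : Type*} [Fintype V] [DecidableEq V] (A : Finset V) (σ : ℕ)
    (a : ℤ) (h : |a| ≤ σ * #A) :
    ∃ g : V → ℤ, (∀ u, u ∉ A → g u = 0) ∧ (∀ u, |g u| ≤ σ) ∧ ∑ u, g u = a := by
  induction A using Finset.induction_on generalizing a with
  | empty =>
    have : a = 0 := by simpa using h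
    exact ⟨fun _ => 0, by simp [this]⟩
  | insert v A hv ih =>
    rw [Finset.card_insert_of_notMem hv] at h
    push_cast at h
    rw [mul_add, mul_one] at h
    set s : ℤ := (σ : ℤ) with hs
    have hs0 : 0 ≤ s := by positivity
    have hp : 0 ≤ s * (#A : ℤ) := by positivity
    obtain ⟨x, hx1, hx2⟩ : ∃ x : ℤ, |x| ≤ s ∧ |a - x| ≤ s * #A := by
      rw [abs_le] at h
      rcases le_or_gt a (-s) with h1 | h1
      · exact ⟨-s, by rw [abs_neg, abs_of_nonneg hs0], by rw [abs_le]; constructor <;> linarith⟩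
      · rcases le_or_gt a s with h2 | h2
        · exact ⟨a, abs_le.mpr ⟨h1.le, h2⟩, by simpa using hp⟩
        · exact ⟨s, by rw [abs_of_nonneg hs0], by rw [abs_le]; constructor <;> linarith⟩
    obtain ⟨g, hg0, hg1, hg2⟩ := ih (a - x) hx2
    refine ⟨fun u => g u + if u = v then x else 0, ?_, ?_, ?_⟩
    · intro u hu
      rw [Finset.mem_insert, not_or] at hu
      simp [hg0 u hu.2, hu.1]
    · intro u
      by_cases huv : u = v
      · subst huv; simpa [hg0 u hv] using hx1
      · simpa [huv] using hg1 u
    · rw [Finset.sum_add_distrib, hg2]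
      simp

/-- The lists depend only on the level, so an injection of each fibre into its list suffices. -/
theorem exists_mem_injOn_fibers {V ι α : Type*} [Fintype V] [DecidableEq ι] (lev : V → ι)
    (L : ι → Finset α) (h : ∀ i, #{v | lev v = i} ≤ #(L i)) :
    ∃ t : V → α, (∀ v, t v ∈ L (lev v)) ∧ ∀ u v, lev u = lev v → t u = t v → u = v := by
  have : ∀ i, Nonempty ({v // lev v = i} ↪ L i) := by
    intro i
    apply Function.Embedding.nonempty_of_card_le
    rw [Fintype.card_coe, Fintype.card_subtype]
    exact h i
  have e := fun i => (this i).some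
  refine ⟨fun v => e (lev v) ⟨v, rfl⟩, fun v => (e (lev v) ⟨v, rfl⟩).2, fun u v huv he => ?_⟩
  have hcast : ∀ i (hv : lev v = i), (e (lev v) ⟨v, rfl⟩ : α) = e i ⟨v, hv⟩ := by
    rintro _ rfl
    rfl
  have key : ∀ i (hu : lev u = i) (hv : lev v = i), ((e i ⟨u, hu⟩ : L i) : α) = e i ⟨v, hv⟩ → u = v := by
    intro i hu hv h
    simpa using (e i).injective (Subtype.ext h)
  exact key (lev u) rfl huv.symm (he.trans (hcast _ huv.symm))

/-- An interval of length `(G + 1) * (k + 2) * M` has at least `G * k * M` elements `x` for which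
`⌊x / M⌋` is not `0` or `1` modulo `k + 2`. -/
theorem le_card_Ico_div_mod_ge_two {M k G : ℕ} (hM : 0 < M) (a L : ℤ)
    (hL : ((G + 1) * ((k + 2) * M) : ℕ) ≤ L) :
    G * (k * M) ≤ #{x ∈ Finset.Ico a (a + L) |
      ¬ (x / (M : ℤ) % ((k + 2 : ℕ) : ℤ) = 0 ∨ x / (M : ℤ) % ((k + 2 : ℕ) : ℤ) = 1)} := by
  set p : ℤ := (((k + 2) * M : ℕ) : ℤ) with hp
  have hM' : (0 : ℤ) < M := by exact_mod_cast hM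
  have hpe : p = (k + 2) * M := by rw [hp]; push_cast; ring
  have hp0 : 0 < p := by rw [hpe]; positivity
  -- `p * z` is the first multiple of the period `p` from `a` on; this alignment costs the extra
  -- period in `hL`. `φ` enumerates the allowed blocks of `G` full periods.
  set z : ℤ := -((-a) / p) with hz
  have hz1 : a ≤ p * z := by
    have := Int.mul_ediv_self_le (x := -a) hp0.ne'
    rw [hz]; linarith
  have hz2 : p * z < a + p := by
    have := Int.lt_mul_ediv_self_add (x := -a) hp0
    rw [hz]; linarith
  set φ : ℕ × ℕ → ℤ := fun i => p * (z + i.1) + (2 * M + i.2) with hφ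
  have hcard : G * (k * M) = #((Finset.range G ×ˢ Finset.range (k * M)).image φ) := by
    rw [Finset.card_image_of_injOn]
    · simp
    · rintro ⟨i, y⟩ hi ⟨i', y'⟩ hi' he
      simp only [Finset.coe_product, Set.mem_prod, Finset.mem_coe, Finset.mem_range] at hi hi'
      simp only [hφ] at he
      have hy : (y : ℤ) < k * M := by exact_mod_cast hi.2
      have hy' : (y' : ℤ) < k * M := by exact_mod_cast hi'.2
      have hdv : p ∣ (y : ℤ) - y' := ⟨i' - i, by linarith⟩
      have hab : |(y : ℤ) - y'| < p := by
        rw [abs_lt, hpe]; constructor <;> nlinarith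
      have h0 := Int.eq_zero_of_abs_lt_dvd hdv hab
      have h1 : (y : ℤ) = y' := by omega
      have h2 : p * ((i : ℤ) - i') = 0 := by rw [h1] at he; linarith
      have h3 := (mul_eq_zero.mp h2).resolve_left hp0.ne'
      ext
      · simp only; omega
      · simp only; omega
  rw [hcard]
  apply Finset.card_le_card
  intro x hx
  simp only [Finset.mem_image, Finset.mem_product, Finset.mem_range, Prod.exists] at hx
  obtain ⟨i, y, ⟨hi, hy⟩, rfl⟩ := hx
  have hy' : (y : ℤ) < k * M := by exact_mod_cast hy
  have hi' : (i : ℤ) + 1 ≤ G := by exact_mod_cast hi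
  have hL' : (G + 1) * p ≤ L := by rw [hpe]; exact_mod_cast hL
  simp only [Finset.mem_filter, Finset.mem_Ico, hφ]
  have h0 : (0 : ℤ) ≤ p * i := by positivity
  have h4 : p * (i + 1) ≤ p * G := by gcongr
  have hy0 : (0 : ℤ) ≤ y := by positivity
  refine ⟨⟨by linarith, by nlinarith⟩, ?_⟩
  have hdiv : (p * (z + i) + (2 * M + y)) / M = (k + 2) * (z + i) + (2 + (y : ℤ) / M) := by
    have e1 : p * (z + i) + (2 * M + y) = y + M * ((k + 2) * (z + i) + 2) := by rw [hpe]; ring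
    rw [e1, Int.add_mul_ediv_left _ _ hM'.ne']
    ring
  have hym : (y : ℤ) / M < k := Int.ediv_lt_of_lt_mul hM' hy'
  have hym0 : 0 ≤ (y : ℤ) / M := by positivity
  have hmod : (p * (z + i) + (2 * M + y)) / M % ((k + 2 : ℕ) : ℤ) = 2 + (y : ℤ) / M := by
    rw [hdiv]
    push_cast
    rw [add_comm, Int.add_mul_emod_self_left, Int.emod_eq_of_lt (by omega) (by omega)]
  rw [hmod]
  omega

/-! ### Weighted degrees as row sums, and counts by colour -/

section ColourCounts

variable {V : Type*} [Fintype V]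

theorem SimpleGraph.weightedDegree_eq_sum (G : SimpleGraph V) [DecidableRel G.Adj]
    (ω : Sym2 V → ℕ) (v : V) : G.weightedDegree ω v = ∑ u ∈ G.neighborFinset v, ω s(v, u) := by
  classical
  unfold SimpleGraph.weightedDegree
  symm
  refine Finset.sum_bij (fun u _ => s(v, u)) ?_ ?_ ?_ ?_
  · intro u hu
    simpa [SimpleGraph.mem_incidenceSet] using hu
  · intro a _ b _ h
    exact Sym2.congr_right.mp h
  · intro e he
    rw [SimpleGraph.mem_incidenceFinset] at he
    obtain ⟨u, rfl⟩ := Sym2.mem_iff_exists.mp he.2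
    exact ⟨u, by simpa using he.1, rfl⟩
  · intro u _
    rfl

/-- Symmetric integer functions allow negative corrections and plain row sums; the passage to
natural weights on edges happens only here. -/
theorem SimpleGraph.hasIrregularWeighting_of_symm (G : SimpleGraph V) [DecidableRel G.Adj] {k : ℕ}
    (F : V → V → ℤ) (hs : ∀ a b, F a b = F b a) (h0 : ∀ a b, ¬ G.Adj a b → F a b = 0)
    (hF : ∀ a b, G.Adj a b → 1 ≤ F a b ∧ F a b ≤ k)
    (hd : ∀ a b, a ≠ b → ∑ z, F a z ≠ ∑ z, F b z) : G.HasIrregularWeighting k := by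
  classical
  set ω : Sym2 V → ℕ := Sym2.lift ⟨fun a b => (F a b).toNat, fun a b => congrArg Int.toNat (hs a b)⟩ with hω
  have hωe : ∀ a b, ω s(a, b) = (F a b).toNat := fun a b => rfl
  refine ⟨ω, ?_, ?_⟩
  · intro e
    induction e with
    | h a b =>
      intro he
      obtain ⟨h1, h2⟩ := hF a b he
      rw [hωe, Set.mem_Icc]
      omega
  · have key : ∀ v, (G.weightedDegree ω v : ℤ) = ∑ z, F v z := by
      intro v
      rw [G.weightedDegree_eq_sum]
      push_cast
      have : ∑ z, F v z = ∑ z ∈ G.neighborFinset v, F v z := by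
        symm
        apply Finset.sum_subset (Finset.subset_univ _)
        intro z _ hz
        exact h0 v z (by simpa using hz)
      rw [this]
      refine Finset.sum_congr rfl fun u hu => ?_
      have := hF v u (by simpa using hu)
      rw [hωe]
      omega
    intro a b hab he
    apply hd a b hab
    rw [← key, ← key, he]

variable {κ : Type*} [DecidableEq κ]

-- The factor `γ` clears the denominators of the colour frequencies, so the bounds stay integral and
-- add up over `I`.
omit [Fintype V] in
theorem card_filter_mem_mul_bounds (N : Finset V) (c : V → κ) {α β γ : ℤ}
    (hlo : ∀ i, α ≤ #{u ∈ N | c u = i} * γ) (hhi : ∀ i, #{u ∈ N | c u = i} * γ ≤ β)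
    (I : Finset κ) :
    #I * α ≤ #{u ∈ N | c u ∈ I} * γ ∧ #{u ∈ N | c u ∈ I} * γ ≤ #I * β := by
  have h : (#{u ∈ N | c u ∈ I} : ℤ) * γ = ∑ i ∈ I, (#{u ∈ N | c u = i} : ℤ) * γ := by
    rw [← Finset.sum_mul]
    congr 1
    rw [Finset.card_eq_sum_card_fiberwise (f := c) (t := I) (fun u hu => by
      simpa using (Finset.mem_filter.mp hu).2)]
    push_cast
    refine Finset.sum_congr rfl fun i hi => ?_
    congr 2
    ext u
    simp only [Finset.mem_filter]
    constructor
    · rintro ⟨⟨h1, _⟩, h3⟩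
      exact ⟨h1, h3⟩
    · rintro ⟨h1, h3⟩
      exact ⟨⟨h1, h3 ▸ hi⟩, h3⟩
  rw [h]
  constructor
  · simpa using Finset.card_nsmul_le_sum I _ α fun i _ => hlo i
  · simpa using Finset.sum_le_card_nsmul I _ β fun i _ => hhi i

/-- Double counting: the colour classes are small if all their traces on neighbourhoods are. -/
theorem SimpleGraph.IsRegularOfDegree.card_colour_class_mul_le {G : SimpleGraph V}
    [DecidableRel G.Adj] {d : ℕ} (hG : G.IsRegularOfDegree d) (c : V → κ) (I : Finset κ) {γ β : ℤ}
    (h : ∀ v, (#{u ∈ G.neighborFinset v | c u ∈ I} : ℤ) * γ ≤ β) :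
    (d : ℤ) * #{v | c v ∈ I} * γ ≤ Fintype.card V * β := by
  have h1 : ∑ v, #{u ∈ G.neighborFinset v | c u ∈ I} = d * #{v | c v ∈ I} := by
    have := Finset.sum_card_bipartiteAbove_eq_sum_card_bipartiteBelow (s := Finset.univ)
      (t := ({v | c v ∈ I} : Finset V)) G.Adj
    have e1 : ∀ v, #(({v | c v ∈ I} : Finset V).bipartiteAbove G.Adj v) =
        #{u ∈ G.neighborFinset v | c u ∈ I} := by
      intro v
      congr 1
      ext u
      simp [Finset.bipartiteAbove, and_comm]
    have e2 : ∀ v, #((Finset.univ : Finset V).bipartiteBelow G.Adj v) = d := by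
      intro v
      rw [← hG v, ← G.card_neighborFinset_eq_degree]
      congr 1
      ext u
      simp [Finset.bipartiteBelow, G.adj_comm]
    simp only [e1, e2] at this
    rw [this]
    simp [mul_comm]
  calc (d : ℤ) * #{v | c v ∈ I} * γ = ∑ v, (#{u ∈ G.neighborFinset v | c u ∈ I} : ℤ) * γ := by
        rw [← Finset.sum_mul]
        congr 1
        exact_mod_cast h1.symm
    _ ≤ ∑ _v : V, β := Finset.sum_le_sum fun v _ => h v
    _ = _ := by simp

end ColourCounts

/-! ### Counting levels and types, and numerical estimates -/

/-- A vertex of level `ℓ` passes the threshold `K` with exactly `ℓ` of the `K` levels; this makes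
the initial weighted degree linear in the level. -/
theorem card_filter_le_add_fst {K r ℓ : ℕ} (hℓ : ℓ ≤ K) :
    #{i : Fin K × Fin r | K ≤ ℓ + i.1.val} = ℓ * r := by
  have : ({i : Fin K × Fin r | K ≤ ℓ + i.1.val} : Finset _) =
      ({i : Fin K | K ≤ ℓ + i.val} : Finset _) ×ˢ Finset.univ := by
    ext i; simp
  rw [this, Finset.card_product, Finset.card_univ, Fintype.card_fin]
  congr 1
  have h := Finset.card_filter_add_card_filter_not (s := (Finset.univ : Finset (Fin K)))
    (fun i => i.val < K - ℓ)
  rw [Fin.card_filter_val_lt, Finset.card_univ, Fintype.card_fin] at h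
  have h' : ∀ i : Fin K, (¬ i.val < K - ℓ) ↔ K ≤ ℓ + i.val := fun i => by omega
  simp only [h'] at h
  omega

theorem card_filter_snd {K r : ℕ} (p : Fin r → Prop) [DecidablePred p] :
    #{i : Fin K × Fin r | p i.2} = K * #{j | p j} := by
  have : ({i : Fin K × Fin r | p i.2} : Finset _) = Finset.univ ×ˢ ({j | p j} : Finset _) := by
    ext i; simp
  rw [this, Finset.card_product, Finset.card_univ, Fintype.card_fin]

/-- Room for the targets: a window of length `h * d` has more integers avoiding the reserved
residues than there are vertices in a level. -/
theorem level_card_le_of_bounds {n d q R h c : ℕ} (hq : 10 ≤ q) (hR : 100 ≤ R)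
    (hd : 100 * q ^ 2 * R ≤ d) (hnh : n * (q + 5) ≤ q * h * d * (q * R))
    (hc : c * (q * R * (q * R)) ≤ n * (q * R + 1)) :
    c ≤ (d / (2 * q * R) - 1) * ((2 * q - 2) * (R * h)) := by
  have hp0 : 0 < 2 * q * R := by positivity
  have hG1 : d < 2 * q * R * (d / (2 * q * R) + 1) := Nat.lt_mul_div_succ d hp0
  have hG2 : 50 * q ≤ d / (2 * q * R) := by
    rw [Nat.le_div_iff_mul_le hp0]
    nlinarith
  obtain ⟨g, hg⟩ : ∃ g, d / (2 * q * R) = g + 1 := ⟨d / (2 * q * R) - 1, by omega⟩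
  rw [hg] at hG1 hG2 ⊢
  rw [Nat.add_sub_cancel]
  obtain ⟨q', rfl⟩ : ∃ q', q = q' + 1 := ⟨q - 1, by omega⟩
  have e1 : 2 * (q' + 1) - 2 = 2 * q' := by omega
  rw [e1]
  have hg49 : 49 * (q' + 1) ≤ g := by omega
  have hK : 0 < (q' + 1) * R := by positivity
  -- compare both bounds after multiplying by `(q + 5) * K`
  have h1 : c * (q' + 1 + 5) * ((q' + 1) * R) ≤ (q' + 1) * h * d * ((q' + 1) * R + 1) := by
    have := Nat.mul_le_mul_right (q' + 1 + 5) hc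
    have h2 := Nat.mul_le_mul_right ((q' + 1) * R + 1) hnh
    refine Nat.le_of_mul_le_mul_right (c := (q' + 1) * R) ?_ hK
    calc _ = c * ((q' + 1) * R * ((q' + 1) * R)) * (q' + 1 + 5) := by ring
      _ ≤ n * ((q' + 1) * R + 1) * (q' + 1 + 5) := this
      _ = n * (q' + 1 + 5) * ((q' + 1) * R + 1) := by ring
      _ ≤ _ := h2
      _ = _ := by ring
  -- The slack `q + 5` against `q` pays for the reserved residues (`q'` for `q`), the rounding of
  -- the number of periods (`g` for `g + 2`) and the uneven classes (`K + 1` for `K`).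
  have h3 : (q' + 1) * ((q' + 1) * R + 1) * (g + 2) ≤ (q' + 1 + 5) * (g * (q' * R)) := by
    have a1 : (q' + 1) * R * (49 * (q' + 1)) ≤ (q' + 1) * R * g := Nat.mul_le_mul_left _ hg49
    have a2 : (q' + 1) * g * 100 ≤ (q' + 1) * g * R := Nat.mul_le_mul_left _ hR
    have a3 : 9 * (g * R) ≤ q' * (g * R) := Nat.mul_le_mul_right _ (by omega)
    have a4 : q' + 1 ≤ (q' + 1) * g := Nat.le_mul_of_pos_right _ (by omega)
    nlinarith
  have h4 : (q' + 1) * h * d * ((q' + 1) * R + 1) ≤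
      (2 * h * ((q' + 1) * R)) * ((q' + 1) * ((q' + 1) * R + 1) * (g + 2)) := by
    calc _ ≤ (q' + 1) * h * (2 * (q' + 1) * R * (g + 1 + 1)) * ((q' + 1) * R + 1) := by gcongr
      _ = _ := by ring
  refine Nat.le_of_mul_le_mul_right (c := (q' + 1 + 5) * ((q' + 1) * R)) ?_ (by positivity)
  calc c * ((q' + 1 + 5) * ((q' + 1) * R)) = c * (q' + 1 + 5) * ((q' + 1) * R) := by ring
    _ ≤ _ := h1.trans h4
    _ ≤ (2 * h * ((q' + 1) * R)) * ((q' + 1 + 5) * (g * (q' * R))) := Nat.mul_le_mul_left _ h3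
    _ = _ := by ring

/-- Room for the conflicts, in the form that the bipartite adjustment needs. -/
theorem conflict_bound_lt {n d q r h c : ℕ} (hr : r = 10000 * q) (hq : 10 ≤ q) (hh : 0 < h)
    (hd : 100 * q ^ 2 * r ^ 2 ≤ d) (hnh : n * (q + 5) ≤ q * h * d * (q * r ^ 2))
    (hc : c * (q * r ^ 2 * r * (q * r ^ 2)) ≤ n * (q * r ^ 2 + 1)) :
    2 * ((2 * (22 * r + 2) + 1) * 2 * c) + 2 * (r ^ 2 * h) <
      r ^ 2 * h * ((d / (2 * r) + 1) / (2 * q)) := by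
  set K : ℕ := q * r ^ 2 with hK
  have hr0 : 100000 ≤ r := by omega
  have hKr : 100 ≤ K := by rw [hK]; nlinarith
  have hK0 : 0 < K := by omega
  have hnd : n ≤ h * d * K := by
    have : n * q ≤ h * d * K * q := by nlinarith
    exact Nat.le_of_mul_le_mul_right this (by omega)
  have hT : (2 * (22 * r + 2) + 1) * 2 * c ≤ 90 * h * d := by
    have e1 : (2 * (22 * r + 2) + 1) * 2 ≤ 89 * r := by omega
    have e2 : 89 * (K + 1) ≤ 90 * K := by omega
    refine Nat.le_of_mul_le_mul_right (c := K * K) ?_ (by positivity)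
    calc (2 * (22 * r + 2) + 1) * 2 * c * (K * K) ≤ 89 * r * c * (K * K) := by gcongr
      _ = 89 * (c * (K * r * K)) := by ring
      _ ≤ 89 * (n * (K + 1)) := by gcongr
      _ = n * (89 * (K + 1)) := by ring
      _ ≤ (h * d * K) * (90 * K) := Nat.mul_le_mul hnd e2
      _ = _ := by ring
  set D : ℕ := d / (2 * r) with hD
  set E : ℕ := (D + 1) / (2 * q) with hE
  have hD1 : d < 2 * r * (D + 1) := Nat.lt_mul_div_succ d (by omega)
  have hE1 : D + 1 < 2 * q * (E + 1) := Nat.lt_mul_div_succ _ (by omega)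
  have hdE : d < 4 * r * q * (E + 1) := by
    calc d < 2 * r * (D + 1) := hD1
      _ ≤ 2 * r * (2 * q * (E + 1)) := by gcongr
      _ = _ := by ring
  -- Here the constant 10000 is used: the right side of the claim is about `r h d / (4 q) = 2500 h
  -- d`, while the conflicts take at most `180 h d`.
  have hrq : 4 * r * q * 2500 = r ^ 2 := by rw [hr]; ring
  have h5 : d * 2500 < r ^ 2 * (E + 1) := by rw [← hrq]; nlinarith
  have h6 : 3 * r ^ 2 ≤ d := by nlinarith [Nat.zero_le (q ^ 2 * r ^ 2), sq_nonneg r, Nat.one_le_pow 2 q (by omega)]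
  have h7 : 180 * d + 2 * r ^ 2 < r ^ 2 * E := by nlinarith
  calc 2 * ((2 * (22 * r + 2) + 1) * 2 * c) + 2 * (r ^ 2 * h) ≤ 2 * (90 * h * d) + 2 * (r ^ 2 * h) := by
        gcongr
    _ = h * (180 * d + 2 * r ^ 2) := by ring
    _ < h * (r ^ 2 * E) := by gcongr
    _ = _ := by ring

theorem card_filter_abs_sub_le {K : ℕ} (x : ℤ) (l : ℕ) :
    #{i : Fin K | |x - (i.val : ℤ)| ≤ l} ≤ 2 * l + 1 := by
  have h : #{i : Fin K | |x - (i.val : ℤ)| ≤ l} ≤ #(Finset.Icc (x - l) (x + l)) := by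
    refine Finset.card_le_card_of_injOn (fun i : Fin K => (i.val : ℤ)) ?_ ?_
    · intro i hi
      have := abs_le.mp (Finset.mem_filter.mp hi).2
      simp only [Finset.coe_Icc, Set.mem_Icc]
      omega
    · intro i _ j _ hij
      exact Fin.ext (by simpa using hij)
  rw [Int.card_Icc] at h
  omega

/-- The count `x` is `d ℓ / K` up to a relative error `1 / K`, so `K x` misses `d ℓ` by at most `d ℓ
/ K ≤ d`. -/
theorem abs_mul_sub_le_of_count_bounds {K r d ℓ x : ℤ} (hK : 0 < K) (hr : 0 < r) (hd : 0 < d)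
    (h1 : ℓ < K) (hlo : ℓ * r * (d * K - d) ≤ x * (K * r * K))
    (hhi : x * (K * r * K) ≤ ℓ * r * (d * K + d)) : |K * x - d * ℓ| ≤ d := by
  have hp : 0 < r * K := by positivity
  have h2 := mul_le_mul_of_nonneg_left h1.le (by positivity : 0 ≤ r * d)
  rw [abs_le]
  constructor
  · refine le_of_mul_le_mul_right ?_ hp
    linarith
  · refine le_of_mul_le_mul_right ?_ hp
    linarith

theorem small_type_count_bounds {K r d x : ℤ} (hK : 2 ≤ K) (hd : 0 < d)
    (hlo : K * 2 * (d * K - d) ≤ x * (K * r * K)) (hhi : x * (K * r * K) ≤ K * 2 * (d * K + d)) :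
    d ≤ x * r ∧ x * r ≤ 3 * d := by
  have hp : 0 < K * K := by positivity
  have h2 : 0 ≤ d * K * (K - 2) := mul_nonneg (by positivity) (by linarith)
  constructor
  · refine le_of_mul_le_mul_right ?_ hp
    linarith
  · refine le_of_mul_le_mul_right ?_ hp
    linarith

theorem single_type_count_bound {K r d x : ℤ} (hK : 2 ≤ K) (hd : 0 < d)
    (hlo : K * 1 * (d * K - d) ≤ x * (K * r * K)) : d ≤ x * (2 * r) := by
  have hp : 0 < K * K := by positivity
  have h2 : 0 ≤ d * K * (K - 2) := mul_nonneg (by positivity) (by linarith)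
  refine le_of_mul_le_mul_right ?_ hp
  linarith

/-! ### The weighting built from an equitable colouring -/

section Main

variable {V : Type*} [Fintype V]

set_option maxHeartbeats 2000000 in
/-- An equitable colouring by levels and types yields an irregular weighting. -/
theorem SimpleGraph.IsRegularOfDegree.hasIrregularWeighting_of_colouring {G : SimpleGraph V}
    [DecidableRel G.Adj] {n d q r K h : ℕ} (hn : Fintype.card V = n) (hG : G.IsRegularOfDegree d)
    (hq : 10 ≤ q) (hr : r = 10000 * q) (hK : K = q * r ^ 2) (hd : 100 * q ^ 2 * r ^ 2 ≤ d)
    (hh : 0 < h) (hnh : n * (q + 5) ≤ q * h * d * K) (c : V → Fin K × Fin r)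
    (hlo : ∀ v i, (d * K - d : ℤ) ≤ (#{u ∈ G.neighborFinset v | c u = i} : ℤ) * (K * r * K))
    (hhi : ∀ v i, (#{u ∈ G.neighborFinset v | c u = i} : ℤ) * (K * r * K) ≤ d * K + d) :
    G.HasIrregularWeighting (h * r ^ 2 * (q + 7)) := by
  classical
  have hr0 : 100000 ≤ r := by omega
  have hK2 : 100 ≤ K := by rw [hK]; nlinarith
  have hd0 : 0 < d := lt_of_lt_of_le (by positivity) hd
  set lev : V → ℤ := fun v => ((c v).1.val : ℤ) with hlev
  have hlev0 : ∀ v, 0 ≤ lev v := fun v => by simp [hlev]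
  have hlevK : ∀ v, lev v < K := fun v => by simp only [hlev]; exact_mod_cast (c v).1.2
  set typ : V → ℕ := fun v => (c v).2.val with htyp
  set M : ℕ := r ^ 2 * h with hM
  -- A correction of at most `2 h d`, shared among at least `d / r` small neighbours, needs shares
  -- of at most `2 h r`.
  set σ : ℕ := 2 * h * r with hσ
  set H : ℕ := K * h with hH
  -- The base weight exceeds the largest total decrease `3 M + σ` of an edge, so final weights are
  -- at least 1.
  set lo : ℕ := 3 * M + σ + 1 with hlo_def
  have hM0 : 0 < M := by positivity
  have hKz : (100 : ℤ) ≤ K := by exact_mod_cast hK2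
  have hrz : (100000 : ℤ) ≤ r := by exact_mod_cast hr0
  have hhz : (1 : ℤ) ≤ h := by exact_mod_cast hh
  have hdz : (1 : ℤ) ≤ d := by exact_mod_cast hd0
  have hcount := fun v (I : Finset (Fin K × Fin r)) =>
    card_filter_mem_mul_bounds (G.neighborFinset v) c (hlo v) (hhi v) I
  -- the initial weighting
  set f₀ : V → V → ℤ := fun a b =>
    if G.Adj a b then lo + (if (K : ℤ) ≤ lev a + lev b then (H : ℤ) else 0) else 0 with hf₀
  have hf₀s : ∀ a b, f₀ a b = f₀ b a := by
    intro a b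
    simp only [hf₀, G.adj_comm a b, add_comm (lev a)]
  have hf₀sum : ∀ v, |∑ z, f₀ v z - (lo * d + h * d * lev v)| ≤ h * d := by
    intro v
    have e1 : ∑ z, f₀ v z = lo * d + H * #{u ∈ G.neighborFinset v | (K : ℤ) ≤ lev v + lev u} := by
      simp only [hf₀]
      rw [← Finset.sum_filter, ← G.neighborFinset_eq_filter, Finset.sum_add_distrib,
        ← Finset.sum_filter]
      simp only [Finset.sum_const, nsmul_eq_mul, G.card_neighborFinset_eq_degree, hG v]
      ring
    have e2 : ({u ∈ G.neighborFinset v | (K : ℤ) ≤ lev v + lev u} : Finset V) =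
        {u ∈ G.neighborFinset v | c u ∈
          ({i : Fin K × Fin r | K ≤ (c v).1.val + i.1.val} : Finset _)} := by
      refine Finset.filter_congr fun u _ => ?_
      simp only [Finset.mem_filter, Finset.mem_univ, true_and, hlev]
      exact_mod_cast Iff.rfl
    have e3 := hcount v {i : Fin K × Fin r | K ≤ (c v).1.val + i.1.val}
    rw [← e2, card_filter_le_add_fst (c v).1.2.le] at e3
    rw [e1]
    set x : ℤ := (#{u ∈ G.neighborFinset v | (K : ℤ) ≤ lev v + lev u} : ℤ) with hx
    obtain ⟨e4, e5⟩ := e3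
    push_cast at e4 e5
    change lev v * r * _ ≤ _ at e4
    change _ ≤ lev v * r * _ at e5
    have e6 : |K * x - d * lev v| ≤ d :=
      abs_mul_sub_le_of_count_bounds (by omega) (by omega) (by omega) (hlevK v) e4 e5
    have e7 : (lo * d + H * x - (lo * d + h * d * lev v) : ℤ) = h * (K * x - d * lev v) := by
      rw [hH]; push_cast; ring
    rw [e7, abs_mul, abs_of_nonneg (by positivity : (0 : ℤ) ≤ h)]
    gcongr
  -- neighbours of the small types
  have hsmall : ∀ v, (d : ℤ) ≤ #{u ∈ G.neighborFinset v | typ u < 2} * r ∧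
      (#{u ∈ G.neighborFinset v | typ u < 2} : ℤ) * r ≤ 3 * d := by
    intro v
    have e1 : ({u ∈ G.neighborFinset v | typ u < 2} : Finset V) = {u ∈ G.neighborFinset v | c u ∈
        ({i : Fin K × Fin r | i.2.val < 2} : Finset _)} :=
      Finset.filter_congr fun u _ => by simp [htyp]
    have e2 := hcount v {i : Fin K × Fin r | i.2.val < 2}
    rw [← e1, card_filter_snd (fun j : Fin r => j.val < 2), Fin.card_filter_val_lt,
      min_eq_right (by omega)] at e2
    obtain ⟨e3, e4⟩ := e2
    push_cast at e3 e4
    exact small_type_count_bounds (by omega) (by omega) e3 e4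
  have htype : ∀ v τ, τ < 2 → d / (2 * r) ≤ #{u ∈ G.neighborFinset v | typ u = τ} := by
    intro v τ hτ
    have e1 : ({u ∈ G.neighborFinset v | typ u = τ} : Finset V) = {u ∈ G.neighborFinset v | c u ∈
        ({i : Fin K × Fin r | i.2.val = τ} : Finset _)} :=
      Finset.filter_congr fun u _ => by simp [htyp]
    have e2 := (hcount v {i : Fin K × Fin r | i.2.val = τ}).1
    have e0 : #{j : Fin r | j.val = τ} = 1 := by
      rw [Finset.card_eq_one]
      exact ⟨⟨τ, by omega⟩, by ext j; simp [Fin.ext_iff]⟩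
    rw [← e1, card_filter_snd (fun j : Fin r => j.val = τ), e0] at e2
    push_cast at e2
    have e3 : (d : ℤ) ≤ #{u ∈ G.neighborFinset v | typ u = τ} * (2 * r) :=
      single_type_count_bound (by omega) (by omega) e2
    refine Nat.div_le_of_le_mul ?_
    rw [mul_comm]
    exact_mod_cast e3
  -- colour classes and levels
  have hclass : ∀ I : Finset (Fin K × Fin r),
      (#{v | c v ∈ I} : ℤ) * (K * r * K) ≤ n * (#I * (K + 1)) := by
    intro I
    have h1 := hG.card_colour_class_mul_le c I fun v => (hcount v I).2
    rw [hn] at h1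
    refine le_of_mul_le_mul_left ?_ (by omega : (0 : ℤ) < d)
    linarith
  set cl : ℕ := n * (K + 1) / (K * r * K) with hcl
  have hclK : cl * (K * r * K) ≤ n * (K + 1) := Nat.div_mul_le_self _ _
  have hclass1 : ∀ i, #{v | c v = i} ≤ cl := by
    intro i
    rw [hcl, Nat.le_div_iff_mul_le (by positivity)]
    have := hclass {i}
    simp only [Finset.mem_singleton, Finset.card_singleton, Nat.cast_one, one_mul] at this
    exact_mod_cast this
  -- targets
  obtain ⟨t, htL, htinj⟩ := exists_mem_injOn_fibers (fun v => (c v).1)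
    (fun i : Fin K => {x ∈ Finset.Ico ((lo : ℤ) * d + h * d * i.val)
      (lo * d + h * d * i.val + h * d) |
      ¬ (x / (M : ℤ) % ((2 * q : ℕ) : ℤ) = 0 ∨ x / (M : ℤ) % ((2 * q : ℕ) : ℤ) = 1)}) (by
    intro i
    have h1 := hclass {j : Fin K × Fin r | j.1 = i}
    have e0 : #{j : Fin K × Fin r | j.1 = i} = r := by
      have : ({j : Fin K × Fin r | j.1 = i} : Finset _) = {i} ×ˢ Finset.univ := by
        ext j
        simp only [Finset.mem_filter, Finset.mem_product, Finset.mem_singleton, Finset.mem_univ,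
          true_and, and_true]
      rw [this, Finset.card_product]
      simp
    rw [e0] at h1
    simp only [Finset.mem_filter, Finset.mem_univ, true_and] at h1
    have h2 : #{v | (c v).1 = i} * (K * K) ≤ n * (K + 1) := by
      have h3 : #{v | (c v).1 = i} * (K * r * K) ≤ n * (r * (K + 1)) := by exact_mod_cast h1
      refine Nat.le_of_mul_le_mul_right (c := r) ?_ (by omega)
      nlinarith
    have h4 := level_card_le_of_bounds hq (by nlinarith) hd (hK ▸ hnh)
      (c := #{v | (c v).1 = i}) (by rw [← hK]; exact h2)
    refine h4.trans ?_
    have hG0 : 0 < d / (2 * q * r ^ 2) := by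
      apply Nat.div_pos _ (by positivity)
      nlinarith
    have h5 := le_card_Ico_div_mod_ge_two (M := M) (k := 2 * q - 2) (G := d / (2 * q * r ^ 2) - 1)
      hM0 ((lo : ℤ) * d + h * d * i.val) (h * d) (by
        rw [Nat.sub_add_cancel hG0, Nat.sub_add_cancel (by omega)]
        have : d / (2 * q * r ^ 2) * (2 * q * M) ≤ h * d := by
          calc d / (2 * q * r ^ 2) * (2 * q * M) = h * (d / (2 * q * r ^ 2) * (2 * q * r ^ 2)) := by
                rw [hM]; ring
            _ ≤ h * d := Nat.mul_le_mul_left _ (Nat.div_mul_le_self _ _)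
        exact_mod_cast this)
    rw [Nat.sub_add_cancel (by omega : 2 ≤ 2 * q)] at h5
    exact h5)
  have htI : ∀ v, lo * d + h * d * lev v ≤ t v ∧ t v < lo * d + h * d * lev v + h * d := fun v => by
    have := (Finset.mem_filter.mp (htL v)).1
    rwa [Finset.mem_Ico] at this
  have htF : ∀ v, ¬ (t v / (M : ℤ) % ((2 * q : ℕ) : ℤ) = 0 ∨ t v / (M : ℤ) % ((2 * q : ℕ) : ℤ) = 1) :=
    fun v => (Finset.mem_filter.mp (htL v)).2
  have htt : ∀ a b, a ≠ b → t a ≠ t b := by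
    intro a b hab he
    obtain ⟨a1, a2⟩ := htI a
    obtain ⟨b1, b2⟩ := htI b
    have hhd : (0 : ℤ) < h * d := by positivity
    have l1 : lev a < lev b + 1 := by
      refine lt_of_mul_lt_mul_left ?_ hhd.le
      linarith
    have l2 : lev b < lev a + 1 := by
      refine lt_of_mul_lt_mul_left ?_ hhd.le
      linarith
    refine hab (htinj a b (Fin.ext ?_) he)
    have l3 : lev a = lev b := by omega
    simp only [hlev] at l3
    exact_mod_cast l3
  -- shares of the corrections
  have hshare : ∀ v, ∃ g : V → ℤ, (∀ u, u ∉ ({u ∈ G.neighborFinset v | typ u < 2} : Finset V) → g u = 0) ∧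
      (∀ u, |g u| ≤ σ) ∧ ∑ u, g u = t v - ∑ z, f₀ v z := by
    intro v
    apply exists_bounded_shares
    have h1 := hf₀sum v
    obtain ⟨h2, h3⟩ := htI v
    have h4 : |t v - ∑ z, f₀ v z| ≤ 2 * h * d := by
      rw [abs_le] at h1 ⊢
      constructor <;> linarith
    refine h4.trans ?_
    rw [hσ]
    push_cast
    nlinarith [(hsmall v).1]
  choose g₀ hg₀0 hg₀σ hg₀sum using hshare
  -- Small vertices issue no corrections. Hence `g a b` and `g b a` are never both nonzero, and
  -- vertices that are not small receive nothing from others.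
  set g : V → V → ℤ := fun a b => if typ a < 2 then 0 else g₀ a b with hg
  have hgS : ∀ a b, typ a < 2 → g a b = 0 := fun a b h => by simp only [hg, if_pos h]
  have hg0 : ∀ a b, ¬ (G.Adj a b ∧ typ b < 2) → g a b = 0 := by
    intro a b hab
    simp only [hg]
    split_ifs
    · rfl
    · exact hg₀0 a b (by simpa using hab)
  have hgσ : ∀ a b, |g a b| ≤ σ := by
    intro a b
    simp only [hg]
    split_ifs
    · simp
    · exact hg₀σ a b
  set w : V → ℤ := fun v => ∑ z, (f₀ v z + (g v z + g z v)) with hw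
  have hwB : ∀ v, ¬ typ v < 2 → w v = t v := by
    intro v hv
    have h1 : ∀ z, g z v = 0 := fun z => hg0 z v fun h => hv h.2
    simp only [hw, Finset.sum_add_distrib, h1]
    have : ∑ z, g v z = ∑ z, g₀ v z := by simp only [hg, if_neg hv]
    rw [this, hg₀sum]
    simp
  have hwS : ∀ v, typ v < 2 → |w v - (lo * d + h * d * lev v)| ≤ h * d + σ * d := by
    intro v hv
    have h1 : ∀ z, g v z = 0 := fun z => hgS v z hv
    have h2 : |∑ z, g z v| ≤ σ * d := by
      have h3 : ∑ z, g z v = ∑ z ∈ G.neighborFinset v, g z v := by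
        symm
        apply Finset.sum_subset (Finset.subset_univ _)
        intro z _ hz
        exact hg0 z v fun h => hz (by simpa using h.1.symm)
      rw [h3]
      calc |∑ z ∈ G.neighborFinset v, g z v| ≤ ∑ z ∈ G.neighborFinset v, |g z v| :=
            Finset.abs_sum_le_sum_abs _ _
        _ ≤ ∑ _z ∈ G.neighborFinset v, (σ : ℤ) := Finset.sum_le_sum fun z _ => hgσ z v
        _ = _ := by simp [hG v, mul_comm]
    have h4 := hf₀sum v
    have h5 : w v = ∑ z, f₀ v z + ∑ z, g z v := by
      simp only [hw, Finset.sum_add_distrib, h1]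
      simp
    rw [h5, show ∑ z, f₀ v z + ∑ z, g z v - (lo * d + h * d * lev v) =
      (∑ z, f₀ v z - (lo * d + h * d * lev v)) + ∑ z, g z v by ring]
    exact (abs_add_le _ _).trans (add_le_add h4 h2)
  -- final adjustment between the two small types
  set P : Finset V := {v | typ v = 0} with hP
  set Q : Finset V := {v | typ v = 1} with hQ
  have hmemP : ∀ v, v ∈ P ↔ typ v = 0 := fun v => by simp [hP]
  have hmemQ : ∀ v, v ∈ Q ↔ typ v = 1 := fun v => by simp [hQ]
  have hmemS : ∀ v, v ∈ P ∨ v ∈ Q ↔ typ v < 2 := fun v => by rw [hmemP, hmemQ]; omega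
  have hPQ : Disjoint P Q := by
    rw [Finset.disjoint_left]
    intro v hv hv'
    rw [hmemP] at hv
    rw [hmemQ] at hv'
    omega
  set Γ : SimpleGraph V := G.between (P : Set V) Q with hΓ
  have hΓadj : ∀ a b, Γ.Adj a b ↔ G.Adj a b ∧ (a ∈ P ∧ b ∈ Q ∨ a ∈ Q ∧ b ∈ P) := fun a b => Iff.rfl
  -- The degree of a small vertex ends within `h d (1 + 11 r)` of `lo d + h d lev`: `h d` initially,
  -- `2 h r d` from received shares, `9 h r d` from the final adjustment. Twice this, in units of `h
  -- d`, is the range of levels in which collisions are possible.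
  set l : ℕ := 22 * r + 2 with hl
  set conf : V → V → Prop := fun a b => typ a < 2 ∧ typ b < 2 ∧ |lev a - lev b| ≤ l with hconf
  have hT : ∀ a, #{b | conf a b} ≤ (2 * l + 1) * 2 * cl := by
    intro a
    set J : Finset (Fin K × Fin r) := ({i : Fin K | |lev a - (i.val : ℤ)| ≤ l} : Finset _) ×ˢ
      ({j : Fin r | j.val < 2} : Finset _) with hJ
    have hJc : #J ≤ (2 * l + 1) * 2 := by
      rw [hJ, Finset.card_product, Fin.card_filter_val_lt]
      exact Nat.mul_le_mul (card_filter_abs_sub_le _ _) (min_le_right _ _)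
    have h1 : #{b | conf a b} ≤ cl * #J := by
      refine Finset.card_le_mul_card_image_of_maps_to (f := c) ?_ cl fun i _ => ?_
      · intro b hb
        obtain ⟨-, -, h2, h3⟩ := Finset.mem_filter.mp hb
        simp only [hJ, Finset.mem_product, Finset.mem_filter, Finset.mem_univ, true_and]
        exact ⟨h3, h2⟩
      · refine (Finset.card_le_card ?_).trans (hclass1 i)
        intro b hb
        simpa using (Finset.mem_filter.mp hb).2
    calc _ ≤ cl * #J := h1
      _ ≤ cl * ((2 * l + 1) * 2) := Nat.mul_le_mul_left _ hJc
      _ = _ := mul_comm _ _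
  have hΓdeg : ∀ v, v ∈ P ∨ v ∈ Q → d / (2 * r) ≤ #(Γ.neighborFinset v) := by
    rintro v (hv | hv)
    · refine (htype v 1 (by norm_num)).trans (Finset.card_le_card ?_)
      intro u hu
      rw [Finset.mem_filter, SimpleGraph.mem_neighborFinset] at hu
      rw [SimpleGraph.mem_neighborFinset, hΓadj]
      exact ⟨hu.1, Or.inl ⟨hv, (hmemQ u).mpr hu.2⟩⟩
    · refine (htype v 0 (by norm_num)).trans (Finset.card_le_card ?_)
      intro u hu
      rw [Finset.mem_filter, SimpleGraph.mem_neighborFinset] at hu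
      rw [SimpleGraph.mem_neighborFinset, hΓadj]
      exact ⟨hu.1, Or.inr ⟨hv, (hmemP u).mpr hu.2⟩⟩
  obtain ⟨f, hfs, hf0, hfM, hfres, hfd⟩ := Γ.exists_bipartite_adjustment P Q hPQ
    (fun a b hab => ((hΓadj a b).mp hab).2) (m := 2 * q) (by omega) hM0 hΓdeg conf
    (fun a b hab => ⟨hab.2.1, hab.1, by rw [abs_sub_comm]; exact hab.2.2⟩) hT
    (conflict_bound_lt hr hq hh hd (hK ▸ hnh) (hK ▸ hclK)) w
  set F : V → V → ℤ := fun a b => f₀ a b + (g a b + g b a) + f a b with hF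
  have hFsum : ∀ v, ∑ z, F v z = w v + ∑ z, f v z := by
    intro v
    simp only [hF, hw]
    rw [Finset.sum_add_distrib]
  have hFB : ∀ v, ¬ typ v < 2 → ∑ z, F v z = t v := by
    intro v hv
    rw [hFsum, hwB v hv, add_eq_left]
    refine Finset.sum_eq_zero fun z _ => hf0 v z fun h => ?_
    rw [hΓadj] at h
    exact hv ((hmemS v).mp (h.2.imp And.left And.left))
  have hFS : ∀ v, typ v < 2 →
      |∑ z, F v z - (lo * d + h * d * lev v)| ≤ h * d + σ * d + 9 * (h * r * d) := by
    intro v hv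
    -- At most `3 d / r` small neighbours, each edge changed by at most `3 M = 3 r² h`.
    have h1 : |∑ z, f v z| ≤ 9 * (h * r * d) := by
      have h3 : ∑ z, f v z = ∑ z ∈ G.neighborFinset v with typ z < 2, f v z := by
        symm
        apply Finset.sum_subset (Finset.subset_univ _)
        intro z _ hz
        refine hf0 v z fun h => hz ?_
        rw [hΓadj] at h
        rw [Finset.mem_filter, SimpleGraph.mem_neighborFinset]
        exact ⟨h.1, (hmemS z).mp ((h.2.imp And.right And.right).symm)⟩
      rw [h3]
      calc |∑ z ∈ G.neighborFinset v with typ z < 2, f v z|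
          ≤ ∑ z ∈ G.neighborFinset v with typ z < 2, |f v z| := Finset.abs_sum_le_sum_abs _ _
        _ ≤ ∑ _z ∈ G.neighborFinset v with typ _z < 2, (3 * M : ℤ) :=
            Finset.sum_le_sum fun z _ => hfM v z
        _ = 3 * (h * r) * (#{u ∈ G.neighborFinset v | typ u < 2} * r) := by
            rw [Finset.sum_const, nsmul_eq_mul, hM]
            push_cast
            ring
        _ ≤ 3 * (h * r) * (3 * d) :=
            mul_le_mul_of_nonneg_left (hsmall v).2 (by positivity)
        _ = _ := by ring
    rw [hFsum, show w v + ∑ z, f v z - (lo * d + h * d * lev v) =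
      (w v - (lo * d + h * d * lev v)) + ∑ z, f v z by ring]
    exact (abs_add_le _ _).trans (add_le_add (hwS v hv) h1)
  refine G.hasIrregularWeighting_of_symm F ?_ ?_ ?_ ?_
  · intro a b
    simp only [hF]
    rw [hf₀s, hfs, add_comm (g a b)]
  · intro a b hab
    have h1 : f₀ a b = 0 := by simp [hf₀, hab]
    have h2 : g a b = 0 := hg0 a b fun h => hab h.1
    have h3 : g b a = 0 := hg0 b a fun h => hab h.1.symm
    have h4 : f a b = 0 := hf0 a b fun h => hab h.1
    simp [hF, h1, h2, h3, h4]
  · intro a b hab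
    have h1 : (lo : ℤ) ≤ f₀ a b ∧ f₀ a b ≤ lo + H := by
      simp only [hf₀, hab, if_true]
      split_ifs
      · exact ⟨by linarith [(Nat.cast_nonneg H : (0 : ℤ) ≤ H)], le_rfl⟩
      · exact ⟨by simp, by linarith [(Nat.cast_nonneg H : (0 : ℤ) ≤ H)]⟩
    have h2 : |g a b + g b a| ≤ σ := by
      by_cases ha : typ a < 2
      · rw [hgS a b ha, zero_add]; exact hgσ b a
      · rw [hg0 b a fun h => ha h.2, add_zero]; exact hgσ a b
    have h3 := abs_le.mp (hfM a b)
    rw [abs_le] at h2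
    have hk : (lo : ℤ) + H + σ + 3 * M ≤ (h * r ^ 2 * (q + 7) : ℕ) := by
      have : lo + H + σ + 3 * M ≤ h * r ^ 2 * (q + 7) := by
        rw [hlo_def, hH, hσ, hM, hK]
        nlinarith
      exact_mod_cast this
    have hlo' : (lo : ℤ) = 3 * M + σ + 1 := by rw [hlo_def]; push_cast; ring
    simp only [hF]
    constructor
    · linarith [h1.1, h2.1, h3.1]
    · linarith [h1.2, h2.2, h3.2]
  · intro a b hab he
    by_cases ha : typ a < 2 <;> by_cases hb : typ b < 2
    · by_cases hc : conf a b
      · rw [hFsum, hFsum] at he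
        exact hfd a b ((hmemS a).mpr ha) ((hmemS b).mpr hb) hab hc he
      · apply hc
        refine ⟨ha, hb, ?_⟩
        have h1 := hFS a ha
        have h2 := hFS b hb
        rw [he] at h1
        have h3 : (h * d : ℤ) * |lev a - lev b| ≤ h * d * l := by
          rw [← abs_of_nonneg (by positivity : (0 : ℤ) ≤ h * d), ← abs_mul,
            abs_of_nonneg (by positivity : (0 : ℤ) ≤ h * d)]
          rw [abs_le] at h1 h2 ⊢
          rw [hσ] at h1 h2
          rw [hl]
          push_cast at h1 h2 ⊢
          constructor <;> nlinarith
        exact le_of_mul_le_mul_left h3 (by positivity)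
    -- A small vertex has a reserved residue, which every target avoids.
    · have h1 := hfres a ((hmemS a).mpr ha)
      rw [← hFsum, he, hFB b hb] at h1
      exact htF b h1
    · have h1 := hfres b ((hmemS b).mpr hb)
      rw [← hFsum, ← he, hFB a ha] at h1
      exact htF a h1
    · rw [hFB a ha, hFB b hb] at he
      exact htt a b hab he

end Main

/-! ### Choice of parameters and the asymptotic bounds -/

section Asymptotics

variable {V : Type*} [Fintype V] {G : SimpleGraph V} [DecidableRel G.Adj]

/-- The colouring is requested with deviation `a = d / (K r K)`, for which `hd` is exactly the
Chernoff condition `4 d log ≤ a²`. -/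
theorem SimpleGraph.IsRegularOfDegree.hasIrregularWeighting_of_log_le {n d q r K h : ℕ}
    (hn : Fintype.card V = n) (hn0 : 0 < n) (hG : G.IsRegularOfDegree d) (hq : 10 ≤ q)
    (hr : r = 10000 * q) (hK : K = q * r ^ 2) (hh : 0 < h) (hnh : n * (q + 5) ≤ q * h * d * K)
    (hd : 4 * ((K : ℝ) * r * K) ^ 2 * Real.log (2 * n * (K * r)) ≤ d) :
    G.HasIrregularWeighting (h * r ^ 2 * (q + 7)) := by
  classical
  have hr0 : 100000 ≤ r := by omega
  have hK2 : 100 ≤ K := by rw [hK]; nlinarith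
  have hKr : (100 : ℝ) ≤ K := by exact_mod_cast hK2
  have hrr : (100000 : ℝ) ≤ r := by exact_mod_cast hr0
  have hnr : (1 : ℝ) ≤ n := by exact_mod_cast hn0
  have hKrr : (100 : ℝ) ≤ K * r := by nlinarith
  have hlog : 1 ≤ Real.log (2 * n * (K * r)) := by
    rw [Real.le_log_iff_exp_le (by positivity)]
    have := Real.exp_one_lt_d9
    nlinarith
  have hγ : (1 : ℝ) ≤ K * r * K := by nlinarith
  have hd1 : 4 * ((K : ℝ) * r * K) ^ 2 ≤ d :=
    (le_mul_of_one_le_right (by positivity) hlog).trans hd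
  have hd1' : 4 * (K * r * K) ^ 2 ≤ d := by exact_mod_cast hd1
  have hd2 : 100 * q ^ 2 * r ^ 2 ≤ d := by
    refine le_trans ?_ hd1'
    have hqK : q ≤ K := by rw [hK]; exact Nat.le_mul_of_pos_right _ (by positivity)
    calc 100 * q ^ 2 * r ^ 2 ≤ K ^ 2 * K ^ 2 * r ^ 2 := by gcongr; nlinarith
      _ = (K * r * K) ^ 2 := by ring
      _ ≤ _ := Nat.le_mul_of_pos_left _ (by norm_num)
  have hd0 : 0 < d := lt_of_lt_of_le (by positivity) hd2
  have hdr : (0 : ℝ) < d := by exact_mod_cast hd0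
  have : NeZero K := ⟨by omega⟩
  have : NeZero r := ⟨by omega⟩
  have hcard : (Fintype.card (Fin K × Fin r) : ℝ) = K * r := by simp
  obtain ⟨c, hc⟩ := hG.exists_coloring_neighbor_count (κ := Fin K × Fin r) hd0
    (a := d / (K * r * K)) (by positivity) (by
      rw [div_le_iff₀ (by positivity)]; nlinarith) (by
      rw [hcard, hn, div_pow, le_div_iff₀ (by positivity)]
      nlinarith)
  rw [hcard] at hc
  refine hG.hasIrregularWeighting_of_colouring hn hq hr hK hd2 hh hnh c ?_ ?_
  all_goals
    intro v i
    have h1 := abs_le.mp (hc v i)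
    have e1 : (d : ℝ) / (K * r) * (K * r * K) = d * K := by field_simp
    have e2 : (d : ℝ) / (K * r * K) * (K * r * K) = d := by field_simp
    have e3 := mul_le_mul_of_nonneg_right h1.1 (by positivity : (0 : ℝ) ≤ K * r * K)
    have e4 := mul_le_mul_of_nonneg_right h1.2 (by positivity : (0 : ℝ) ≤ K * r * K)
  · have : (d * K - d : ℝ) ≤ (#{u ∈ G.neighborFinset v | c u = i} : ℝ) * (K * r * K) := by
      rw [sub_mul, neg_mul] at e3
      linarith
    exact_mod_cast this
  · have : (#{u ∈ G.neighborFinset v | c u = i} : ℝ) * (K * r * K) ≤ d * K + d := by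
      rw [sub_mul] at e4
      linarith
    exact_mod_cast this

/-- Here `h` is `y = n (q + 5) / (q d K)` rounded up. Unrounded it gives `(n / d) (q + 5)(q + 7) /
q²`, at most `(n / d)(1 + 16 / q)`; rounding adds at most `r² (q + 7)`, which `hnd` bounds by `(n /
d) / q`. The power `q ^ 14` comes from `(K r K)²`. -/
theorem SimpleGraph.IsRegularOfDegree.exists_hasIrregularWeighting_le {n d q : ℕ}
    (hn : Fintype.card V = n) (hn0 : 0 < n) (hG : G.IsRegularOfDegree d) (hd0 : 0 < d)
    (hq : 10 ≤ q)
    (hd : 4 * 10 ^ 40 * (q : ℝ) ^ 14 * Real.log (2 * n * (10 ^ 12 * q ^ 4)) ≤ d)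
    (hnd : 2 * 10 ^ 8 * (q : ℝ) ^ 4 ≤ n / d) :
    ∃ k : ℕ, 1 ≤ k ∧ G.HasIrregularWeighting k ∧ (k : ℝ) ≤ n / d * (1 + 17 / q) := by
  set r : ℕ := 10000 * q with hr
  set K : ℕ := q * r ^ 2 with hK
  have hqr : (10 : ℝ) ≤ q := by exact_mod_cast hq
  have hdr : (0 : ℝ) < d := by exact_mod_cast hd0
  have hnr : (0 : ℝ) < n := by exact_mod_cast hn0
  have hrc : (r : ℝ) = 10000 * q := by rw [hr]; push_cast; ring
  have hKc : (K : ℝ) = 10 ^ 8 * q ^ 3 := by rw [hK]; push_cast; rw [hrc]; ring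
  have hK0 : (0 : ℝ) < K := by rw [hKc]; positivity
  set y : ℝ := n * (q + 5) / (q * d * K) with hy
  have hy0 : 0 < y := by positivity
  have hnh : n * (q + 5) ≤ q * ⌈y⌉₊ * d * K := by
    have h1 : y ≤ (⌈y⌉₊ : ℝ) := Nat.le_ceil y
    rw [hy, div_le_iff₀ (by positivity), ← hy] at h1
    have h2 : (n * (q + 5) : ℝ) ≤ q * ⌈y⌉₊ * d * K := by linarith
    exact_mod_cast h2
  have hh : 0 < ⌈y⌉₊ := Nat.ceil_pos.mpr hy0
  have hmain := hG.hasIrregularWeighting_of_log_le hn hn0 hq hr hK hh hnh (by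
    have e1 : 4 * ((K : ℝ) * r * K) ^ 2 = 4 * 10 ^ 40 * (q : ℝ) ^ 14 := by rw [hKc, hrc]; ring
    have e2 : (K : ℝ) * r = 10 ^ 12 * q ^ 4 := by rw [hKc, hrc]; ring
    rw [e1, e2]
    exact hd)
  refine ⟨_, ?_, hmain, ?_⟩
  · have hr1 : 0 < r := by omega
    exact Nat.one_le_iff_ne_zero.mpr (by positivity)
  · have h1 : (⌈y⌉₊ : ℝ) ≤ y + 1 := (Nat.ceil_lt_add_one hy0.le).le
    push_cast
    rw [hrc]
    have h2 : (⌈y⌉₊ : ℝ) * (10000 * q) ^ 2 * (q + 7) ≤ (y + 1) * (10000 * q) ^ 2 * (q + 7) := by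
      gcongr
    have h3 : y * (10000 * q) ^ 2 * (q + 7) = n / d * ((q + 5) * (q + 7) / q ^ 2) := by
      rw [hy, hKc]
      field_simp
      ring
    have h4 : ((q : ℝ) + 5) * (q + 7) / q ^ 2 ≤ 1 + 16 / q := by
      rw [div_le_iff₀ (by positivity)]
      field_simp
      nlinarith
    have h5 : (10000 * q : ℝ) ^ 2 * (q + 7) ≤ n / d * (1 / q) := by
      have : (10000 * q : ℝ) ^ 2 * (q + 7) ≤ 2 * 10 ^ 8 * (q : ℝ) ^ 4 * (1 / q) := by
        field_simp
        nlinarith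
      exact this.trans (by gcongr)
    calc (⌈y⌉₊ : ℝ) * (10000 * q) ^ 2 * (q + 7) ≤ (y + 1) * (10000 * q) ^ 2 * (q + 7) := h2
      _ = y * (10000 * q) ^ 2 * (q + 7) + (10000 * q) ^ 2 * (q + 7) := by ring
      _ ≤ n / d * (1 + 16 / q) + n / d * (1 / q) := by
          rw [h3]
          gcongr
      _ = _ := by ring

/-- With `x = L ^ (ε / 19)` and `q = ⌈17 x⌉`, the error `17 / q` is at most `1 / x`. The colouring
needs `d` of order `q ^ 14 L`, while `d ≥ L x ^ 19`; the spare `x ^ 5` absorbs the constants. -/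
theorem SimpleGraph.IsRegularOfDegree.exists_hasIrregularWeighting_le_of_log_rpow {n d : ℕ}
    {ε : ℝ} (hn : Fintype.card V = n) (hG : G.IsRegularOfDegree d)
    (hx : 10 ^ 20 ≤ Real.log n ^ (ε / 19)) (hL : 1 ≤ Real.log n)
    (hlo : Real.log n ^ (1 + ε) ≤ d) (hhi : (d : ℝ) ≤ n / Real.log n ^ ε) :
    0 < d ∧ ∃ k : ℕ, 1 ≤ k ∧ G.HasIrregularWeighting k ∧
      (k : ℝ) ≤ n / d * (1 + 1 / Real.log n ^ (ε / 19)) := by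
  set L : ℝ := Real.log n with hLdef
  set x : ℝ := L ^ (ε / 19) with hxdef
  have hL0 : 0 < L := by linarith
  have hx0 : 0 < x := by positivity
  have hn0 : 0 < n := by
    rcases Nat.eq_zero_or_pos n with h | h
    · rw [hLdef, h] at hL
      norm_num at hL
    · exact h
  have hnr : (0 : ℝ) < n := by exact_mod_cast hn0
  have hxε : L ^ ε = x ^ 19 := by
    rw [hxdef, ← Real.rpow_natCast, ← Real.rpow_mul hL0.le]
    norm_num
  have hx1ε : L ^ (1 + ε) = L * x ^ 19 := by rw [Real.rpow_add hL0, Real.rpow_one, hxε]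
  rw [hx1ε] at hlo
  rw [hxε] at hhi
  have hdr : (0 : ℝ) < d := lt_of_lt_of_le (by positivity) hlo
  have hd0 : 0 < d := by exact_mod_cast hdr
  have hd1 : (1 : ℝ) ≤ d := by exact_mod_cast hd0
  refine ⟨hd0, ?_⟩
  have hnd : x ^ 19 ≤ n / d := by
    rw [le_div_iff₀ (by positivity)] at hhi
    rw [le_div_iff₀ hdr]
    linarith
  set q : ℕ := ⌈17 * x⌉₊ with hq
  have hq1 : 17 * x ≤ q := Nat.le_ceil _
  have hq2 : (q : ℝ) ≤ 18 * x := by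
    have : (q : ℝ) < 17 * x + 1 := Nat.ceil_lt_add_one (by positivity)
    linarith
  have hq10 : 10 ≤ q := by
    have : (10 : ℝ) ≤ q := by linarith
    exact_mod_cast this
  have hq4 : (q : ℝ) ^ 4 ≤ 10 ^ 6 * x ^ 4 := by
    calc (q : ℝ) ^ 4 ≤ (18 * x) ^ 4 := by gcongr
      _ = 18 ^ 4 * x ^ 4 := by ring
      _ ≤ _ := by gcongr; norm_num
  have hq14 : (q : ℝ) ^ 14 ≤ 10 ^ 18 * x ^ 14 := by
    calc (q : ℝ) ^ 14 ≤ (18 * x) ^ 14 := by gcongr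
      _ = 18 ^ 14 * x ^ 14 := by ring
      _ ≤ _ := by gcongr; norm_num
  have hx5 : (10 : ℝ) ^ 100 ≤ x ^ 5 := by
    calc (10 : ℝ) ^ 100 = (10 ^ 20) ^ 5 := by norm_num
      _ ≤ _ := by gcongr
  have hx15 : (10 : ℝ) ^ 100 ≤ x ^ 15 :=
    hx5.trans (pow_le_pow_right₀ (by linarith) (by norm_num))
  have hpow : ∀ {A : ℝ}, A ≤ 10 ^ 100 → A * x ^ 4 ≤ x ^ 19 := by
    intro A hA
    calc A * x ^ 4 ≤ x ^ 15 * x ^ 4 := by gcongr; exact hA.trans hx15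
      _ = _ := by ring
  have hn19 : x ^ 19 ≤ n := hnd.trans (div_le_self hnr.le hd1)
  have hlog : Real.log (2 * n * (10 ^ 12 * q ^ 4)) ≤ 2 * L := by
    have h1 : 2 * (10 ^ 12 * (q : ℝ) ^ 4) ≤ n := by
      calc 2 * (10 ^ 12 * (q : ℝ) ^ 4) ≤ 2 * (10 ^ 12 * (10 ^ 6 * x ^ 4)) := by gcongr
        _ = (2 * 10 ^ 18) * x ^ 4 := by ring
        _ ≤ x ^ 19 := hpow (by norm_num)
        _ ≤ n := hn19
    have hq0 : (0 : ℝ) < q := by linarith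
    calc Real.log (2 * n * (10 ^ 12 * q ^ 4)) ≤ Real.log (n * n) := by
          apply Real.log_le_log (by positivity)
          nlinarith
      _ = 2 * L := by rw [Real.log_mul hnr.ne' hnr.ne', hLdef]; ring
  obtain ⟨k, hk1, hk, hkle⟩ := hG.exists_hasIrregularWeighting_le hn hn0 hd0 hq10 (by
      refine le_trans ?_ hlo
      calc 4 * 10 ^ 40 * (q : ℝ) ^ 14 * Real.log (2 * n * (10 ^ 12 * q ^ 4))
          ≤ 4 * 10 ^ 40 * (q : ℝ) ^ 14 * (2 * L) := by gcongr
        _ ≤ 4 * 10 ^ 40 * (10 ^ 18 * x ^ 14) * (2 * L) := by gcongr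
        _ = L * ((8 * 10 ^ 58) * x ^ 14) := by ring
        _ ≤ L * (x ^ 5 * x ^ 14) := by
            gcongr
            exact le_trans (by norm_num) hx5
        _ = _ := by ring) (by
      refine le_trans ?_ hnd
      calc 2 * 10 ^ 8 * (q : ℝ) ^ 4 ≤ 2 * 10 ^ 8 * (10 ^ 6 * x ^ 4) := by gcongr
        _ = (2 * 10 ^ 14) * x ^ 4 := by ring
        _ ≤ x ^ 19 := hpow (by norm_num))
  refine ⟨k, hk1, hk, hkle.trans ?_⟩
  have hq0 : (0 : ℝ) < q := by linarith
  have : 17 / (q : ℝ) ≤ 1 / x := by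
    rw [div_le_div_iff₀ hq0 hx0]
    linarith
  gcongr

/-- Since all weights lie in `[1, k]`, the distinct weighted degrees lie in `[d, k d]`, which has at
most `k d` elements because `d > 0`. -/
theorem SimpleGraph.HasIrregularWeighting.card_le_mul {k d : ℕ} (h : G.HasIrregularWeighting k)
    (hG : G.IsRegularOfDegree d) (hd : 0 < d) : Fintype.card V ≤ k * d := by
  obtain ⟨ω, hω, hne⟩ := h
  have hmem : ∀ v, G.weightedDegree ω v ∈ Finset.Icc d (k * d) := by
    intro v
    have hv : ∀ u ∈ G.neighborFinset v, ω s(v, u) ∈ Set.Icc 1 k := fun u hu =>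
      hω _ (by simpa using hu)
    rw [G.weightedDegree_eq_sum, Finset.mem_Icc]
    have h1 := Finset.card_nsmul_le_sum (G.neighborFinset v) (fun u => ω s(v, u)) 1
      fun u hu => (hv u hu).1
    have h2 := Finset.sum_le_card_nsmul (G.neighborFinset v) (fun u => ω s(v, u)) k
      fun u hu => (hv u hu).2
    rw [G.card_neighborFinset_eq_degree, hG v, smul_eq_mul] at h1 h2
    exact ⟨by simpa using h1, by simpa [mul_comm] using h2⟩
  have hcard : Fintype.card V ≤ #(Finset.Icc d (k * d)) := by
    rw [← Finset.card_univ]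
    refine Finset.card_le_card_of_injOn (fun v => G.weightedDegree ω v) (fun v _ => by
      simpa using hmem v) ?_
    intro a _ b _ hab
    by_contra hne'
    exact hne a b hne' hab
  rw [Nat.card_Icc] at hcard
  omega

omit [DecidableRel G.Adj] in
theorem SimpleGraph.irregularityStrength_le {k : ℕ} (hk : 1 ≤ k) (h : G.HasIrregularWeighting k) :
    G.irregularityStrength ≤ k :=
  Nat.sInf_le ⟨hk, h⟩

omit [DecidableRel G.Adj] in
theorem SimpleGraph.IrregularityStrengthDefined.hasIrregularWeighting
    (h : G.IrregularityStrengthDefined) : G.HasIrregularWeighting G.irregularityStrength :=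
  (Nat.sInf_mem (s := {k : ℕ | 1 ≤ k ∧ G.HasIrregularWeighting k}) h).2

end Asymptotics

open Filter in
theorem eventually_le_log_rpow {ε : ℝ} (hε : 0 < ε) (c : ℝ) :
    ∃ N : ℕ, ∀ n : ℕ, N ≤ n → c ≤ Real.log n ^ (ε / 19) ∧ 1 ≤ Real.log n := by
  have h1 : Tendsto (fun n : ℕ => Real.log n) atTop atTop :=
    Real.tendsto_log_atTop.comp tendsto_natCast_atTop_atTop
  have h2 : Tendsto (fun n : ℕ => Real.log n ^ (ε / 19)) atTop atTop :=
    (tendsto_rpow_atTop (by positivity)).comp h1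
  exact eventually_atTop.mp
    ((h2.eventually_ge_atTop c).and (h1.eventually_ge_atTop 1))

theorem corollary2 (ε₀ : ℝ) (hε₀ : 0 < ε₀) :
    (∃ N : ℕ, ∀ (V : Type u) [Fintype V] (G : SimpleGraph V) [DecidableRel G.Adj] (n d : ℕ),
      Fintype.card V = n → N ≤ n → G.IsRegularOfDegree d →
      Real.log (n : ℝ) ^ (1 + ε₀) ≤ (d : ℝ) →
      (d : ℝ) ≤ (n : ℝ) / Real.log (n : ℝ) ^ ε₀ →
      G.IrregularityStrengthDefined ∧
      (G.irregularityStrength : ℝ) ≤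
        (n : ℝ) / (d : ℝ) * (1 + 1 / Real.log (n : ℝ) ^ (ε₀ / 19))) ∧
    (∀ δ : ℝ, 0 < δ →
      ∃ N : ℕ, ∀ (V : Type u) [Fintype V] (G : SimpleGraph V) [DecidableRel G.Adj] (n d : ℕ),
      Fintype.card V = n → N ≤ n → G.IsRegularOfDegree d →
      Real.log (n : ℝ) ^ (1 + ε₀) ≤ (d : ℝ) →
      (d : ℝ) ≤ (n : ℝ) / Real.log (n : ℝ) ^ ε₀ →
      G.IrregularityStrengthDefined ∧
      |(G.irregularityStrength : ℝ) - (n : ℝ) / (d : ℝ)| ≤ δ * ((n : ℝ) / (d : ℝ))) := by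
  refine ⟨?_, fun δ hδ => ?_⟩
  · obtain ⟨N, hN⟩ := eventually_le_log_rpow hε₀ (10 ^ 20)
    refine ⟨N, fun V _ G _ n d hn hNn hG hlo hhi => ?_⟩
    obtain ⟨hx, hL⟩ := hN n hNn
    obtain ⟨-, k, hk1, hk, hkle⟩ :=
      hG.exists_hasIrregularWeighting_le_of_log_rpow hn hx hL hlo hhi
    refine ⟨⟨k, hk1, hk⟩, le_trans ?_ hkle⟩
    exact_mod_cast SimpleGraph.irregularityStrength_le hk1 hk
  · obtain ⟨N, hN⟩ := eventually_le_log_rpow hε₀ (max (10 ^ 20) (1 / δ))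
    refine ⟨N, fun V _ G _ n d hn hNn hG hlo hhi => ?_⟩
    obtain ⟨hx, hL⟩ := hN n hNn
    obtain ⟨hd0, k, hk1, hk, hkle⟩ :=
      hG.exists_hasIrregularWeighting_le_of_log_rpow hn ((le_max_left _ _).trans hx) hL hlo hhi
    have hdef : G.IrregularityStrengthDefined := ⟨k, hk1, hk⟩
    refine ⟨hdef, ?_⟩
    have hdr : (0 : ℝ) < d := by exact_mod_cast hd0
    have hnd : (0 : ℝ) ≤ (n : ℝ) / d := by positivity
    have hlower : (n : ℝ) / d ≤ G.irregularityStrength := by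
      rw [div_le_iff₀ hdr]
      exact_mod_cast hn ▸ hdef.hasIrregularWeighting.card_le_mul hG hd0
    have hupper : (G.irregularityStrength : ℝ) ≤ k := by
      exact_mod_cast SimpleGraph.irregularityStrength_le hk1 hk
    have hinv : 1 / Real.log n ^ (ε₀ / 19) ≤ δ :=
      
      (one_div_le hδ (Real.rpow_pos_of_pos (by linarith) _)).mp ((le_max_right _ _).trans hx)
    have hmul := mul_le_mul_of_nonneg_left hinv hnd
    rw [abs_of_nonneg (sub_nonneg.mpr hlower)]
    linarith
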